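/- Model. Samples $i=1,2,\dots$ of a Wiener process $(W_t)_{t\ge 0}$ are generated at times $S_i$ and sent over an unreliable channel; sample $i$ is delivered at $D_i=S_i+Y_i$, and at that time the sampler learns whether the transmission succeeded. The transmission times $Y_i$ are i.i.d. (distributed as $Y$) with $\mathbb{E}[Y^2]<\infty$ and $Y_i\ge\epsilon$ for some $\epsilon>0$; transmissions fail i.i.d. with probability $\alpha\in[0,1)$; transmission times, failures and $(W_t)$ are independent. Put $D_0=0$. Let $U_t$ be the generation time of the freshest sample successfully delivered by time $t$ ($U_t=0$ before the first success), let $\Delta_t=t-U_t$ be the age of information, and let $\hat W_t=W_{U_t}$ be the estimator. A signal-agnostic policy is a sequence $(S_i)_{i\ge1}$ of random times which is independent of the Wiener process (jointly with the channel), causal (for each $i$, the sampling times $S_1,\dots,S_i$ and the outcomes and durations of transmissions $1,\dots,i-1$ are jointly independent of the outcomes and durations of transmissions $i,i+1,\dots$), and such that (i) $S_i\ge D_{i-1}$, and (ii) for each $i$, $S_i-D_{i-1}$ is bounded by a random variable with finite second moment that is independent of the timing history (sampling times, and outcomes and durations of earlier transmissions) up to $S_{i-1}$. Let $$\text{age}_{\text{opt}}=\inf_{\pi}\limsup_{T\to\infty}\frac1T\,\mathbb{E}\Big[\int_0^T\Delta_t\,dt\Big],\qquad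 \text{mse}_{\text{opt}}=\inf_{\pi}\limsup_{T\to\infty}\frac1T\,\mathbb{E}\Big[\int_0^T(W_t-\hat W_t)^2\,dt\Big],$$ the infima being over all signal-agnostic policies $\pi=(S_i)_{i\ge 1}$ (no regenerative-process assumption). Theorem. Let $Y,Y_{j,1},Y_{j,2},\dots$ be i.i.d. with the distribution of the transmission times, let $M$ be independent of them and geometric, $\mathbb{P}(M=m)=\alpha^{m-1}(1-\alpha)$ for $m\ge1$, and let $Y'=\sum_{k=1}^{M}Y_{j,k}$. Then the expectations in $$\mathbb{E}\left[\int_{Y}^{\max\left(\beta-\frac{\mathbb{E}[Y]}{1-\alpha},\,Y\right)+Y'}t\,dt\right]-\beta\,\mathbb{E}\left[\max\left(\beta-Y,\ \frac{\mathbb{E}[Y]}{1-\alpha}\right)\right]=0$$ are finite for every real $\beta$, and this equation has exactly one real root $\beta$, which is positive. For this $\beta$, $\text{age}_{\text{opt}}=\text{mse}_{\text{opt}}=\beta$, and the policy $$S_{i+1}=\inf\left\{t\ge D_i:\ \Delta_t\ge\beta-\frac{\mathbb{E}[Y]}{1-\alpha}\right\},\qquad i=0,1,2,\dots,$$ (the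 infimum being attained) exists, is signal-agnostic, and attains both $\text{age}_{\text{opt}}$ and $\text{mse}_{\text{opt}}$. -/

import Mathlib

open MeasureTheory ProbabilityTheory Filter
open scoped ENNReal NNReal

noncomputable section

namespace Sampling

variable {Ω : Type*} [MeasurableSpace Ω]

/-! Transmissions are numbered `0, 1, 2, …`. Transmission `i` has transmission time `Y i` and channel
state `C i` (`true`: successful, `false`: failed). A sampling policy is a sequence `S`, where `S i` is
the time at which sample `i` is generated and sent. -/

/-- The unreliable channel with failure probability `α`: i.i.d. transmission times, bounded below by
some `ε > 0` and with finite second moment, i.i.d. channel states, and transmission times and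
channel states mutually independent. -/
structure IsUnreliableChannel (P : Measure Ω) (α : ℝ) (Y : ℕ → Ω → ℝ) (C : ℕ → Ω → Bool) :
    Prop where
  measurable_delay : ∀ i, Measurable (Y i)
  measurable_state : ∀ i, Measurable (C i)
  delay_ge : ∃ ε : ℝ, 0 < ε ∧ ∀ i ω, ε ≤ Y i ω
  memLp_delay : ∀ i, MemLp (Y i) 2 P
  identDistrib_delay : ∀ i, IdentDistrib (Y i) (Y 0) P P
  prob_failure : ∀ i, P {ω | C i ω = false} = ENNReal.ofReal α
  iIndepFun_pair : iIndepFun (fun i ω => (Y i ω, C i ω)) P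
  indepFun_delay_state : ∀ i, IndepFun (Y i) (C i) P

/-- `feedback S Y i` is the time from which sample `i` may be generated: time `0` for the first
sample, and afterwards the delivery time `S (i - 1) + Y (i - 1)` of the preceding sample, at which
its acknowledgment arrives. -/
def feedback (S Y : ℕ → Ω → ℝ) : ℕ → Ω → ℝ
  | 0 => fun _ => 0
  | i + 1 => fun ω => S i ω + Y i ω

/-- Generation time of the freshest sample that has been successfully delivered by time `t`; the
initial value, valid until the first successful delivery, is `0`. -/
def freshest (S Y : ℕ → Ω → ℝ) (C : ℕ → Ω → Bool) (t : ℝ) (ω : Ω) : ℝ :=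
  sSup {s : ℝ | s = 0 ∨ ∃ i, C i ω = true ∧ S i ω + Y i ω ≤ t ∧ s = S i ω}

/-- The age of information `Δ_t`. -/
def age (S Y : ℕ → Ω → ℝ) (C : ℕ → Ω → Bool) (t : ℝ) (ω : Ω) : ℝ :=
  t - freshest S Y C t ω

/-- The estimator of the destination: the value of the signal at the generation time of the
freshest delivered sample. -/
def estimator (W : ℝ≥0 → Ω → ℝ) (S Y : ℕ → Ω → ℝ) (C : ℕ → Ω → Bool) (t : ℝ) (ω : Ω) : ℝ :=
  W (freshest S Y C t ω).toNNReal ω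

/-- Timing history up to (and including) the sampling time `S i`: the sampling times
`S 0, …, S i` and the transmission times and channel states of the transmissions `0, …, i - 1`. -/
def history (S Y : ℕ → Ω → ℝ) (C : ℕ → Ω → Bool) (i : ℕ) (ω : Ω) :
    (Fin (i + 1) → ℝ) × (Fin i → ℝ × Bool) :=
  (fun j => S j ω, fun j => (Y j ω, C j ω))

/-- The signal-agnostic causal sampling policies. -/
structure IsSignalAgnostic (P : Measure Ω) (W : ℝ≥0 → Ω → ℝ) (Y : ℕ → Ω → ℝ) (C : ℕ → Ω → Bool)
    (S : ℕ → Ω → ℝ) : Prop where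
  measurable : ∀ i, Measurable (S i)
  /-- The sampling decisions do not depend on the Wiener process. -/
  agnostic : IndepFun (fun ω t => W t ω) (fun ω i => (S i ω, Y i ω, C i ω)) P
  /-- Causality: what has been decided and observed up to the sampling time `S i` is independent of
  the outcomes of the transmissions `i, i + 1, …`. -/
  causal : ∀ i, IndepFun (history S Y C i) (fun ω (k : ℕ) => (Y (i + k) ω, C (i + k) ω)) P
  /-- A sample is generated only after the feedback on the preceding one. -/
  feasible : ∀ i ω, feedback S Y i ω ≤ S i ω
  /-- Each waiting time is bounded by a random variable with finite second moment which is
  independent of the history up to the preceding sampling time (no history for the first sample). -/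
  bounded : ∀ i, ∃ B : Ω → ℝ, MemLp B 2 P ∧ (∀ᵐ ω ∂P, S i ω - feedback S Y i ω ≤ B ω) ∧
    ∀ k, i = k + 1 → IndepFun B (history S Y C k) P

/-- Long-term average age `limsup_{T → ∞} (1/T) E[∫_0^T Δ_t dt]`. -/
def avgAge (P : Measure Ω) (Y : ℕ → Ω → ℝ) (C : ℕ → Ω → Bool) (S : ℕ → Ω → ℝ) : ℝ≥0∞ :=
  limsup (fun T : ℝ =>
    (∫⁻ ω, (∫⁻ t in Set.Ioc (0 : ℝ) T, ENNReal.ofReal (age S Y C t ω)) ∂P) / ENNReal.ofReal T) atTop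

/-- Long-term average mean square estimation error
`limsup_{T → ∞} (1/T) E[∫_0^T (W_t - Ŵ_t)² dt]`. -/
def avgMSE (P : Measure Ω) (W : ℝ≥0 → Ω → ℝ) (Y : ℕ → Ω → ℝ) (C : ℕ → Ω → Bool)
    (S : ℕ → Ω → ℝ) : ℝ≥0∞ :=
  limsup (fun T : ℝ =>
    (∫⁻ ω, (∫⁻ t in Set.Ioc (0 : ℝ) T,
      ENNReal.ofReal ((W t.toNNReal ω - estimator W S Y C t ω) ^ 2)) ∂P) / ENNReal.ofReal T) atTop

/-- The optimal long-term average age over the signal-agnostic policies. -/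
def ageOpt (P : Measure Ω) (W : ℝ≥0 → Ω → ℝ) (Y : ℕ → Ω → ℝ) (C : ℕ → Ω → Bool) : ℝ≥0∞ :=
  ⨅ (S : ℕ → Ω → ℝ) (_ : IsSignalAgnostic P W Y C S), avgAge P Y C S

/-- The optimal long-term average mean square error over the signal-agnostic policies. -/
def mseOpt (P : Measure Ω) (W : ℝ≥0 → Ω → ℝ) (Y : ℕ → Ω → ℝ) (C : ℕ → Ω → Bool) : ℝ≥0∞ :=
  ⨅ (S : ℕ → Ω → ℝ) (_ : IsSignalAgnostic P W Y C S), avgMSE P W Y C S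

/-- The threshold rule: each sample is generated at the first time, from the arrival of the
feedback on, at which the age is at least `v`. -/
def IsAgeThresholdPolicy (Y : ℕ → Ω → ℝ) (C : ℕ → Ω → Bool) (v : ℝ) (S : ℕ → Ω → ℝ) : Prop :=
  ∀ i ω, IsLeast {t : ℝ | feedback S Y i ω ≤ t ∧ v ≤ age S Y C t ω} (S i ω)

/-- `V 0` (playing the role of `Y`) and `V 1, V 2, …` (playing the role of `Y_{j,1}, Y_{j,2}, …`) are
i.i.d. with the distribution of `Y₀`, and `M` is an independent geometric random variable on
`{1, 2, …}` with success probability `1 - α`. -/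
structure IsEpochSample {Ω' : Type*} [MeasurableSpace Ω'] (P : Measure Ω) (Y₀ : Ω → ℝ) (α : ℝ)
    (Q : Measure Ω') (V : ℕ → Ω' → ℝ) (M : Ω' → ℕ) : Prop where
  measurable_delay : ∀ k, Measurable (V k)
  measurable_count : Measurable M
  identDistrib : ∀ k, IdentDistrib (V k) Y₀ Q P
  geometric : ∀ m : ℕ, Q {ω | M ω = m + 1} = ENNReal.ofReal (α ^ m * (1 - α))
  iIndepFun_delay : iIndepFun V Q
  indepFun_count : IndepFun M (fun ω k => V k ω) Q

/-- The geometric sum of delays `Y' = ∑_{k=1}^M Y_{j,k}`. -/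
def delaySum (V : ℕ → Ω → ℝ) (M : Ω → ℕ) (ω : Ω) : ℝ :=
  ∑ k ∈ Finset.Icc 1 (M ω), V k ω

/-- `∫_Y^{max(b - E[Y]/(1-α), Y) + Y'} t dt`. -/
def epochCost (Q : Measure Ω) (α : ℝ) (V : ℕ → Ω → ℝ) (M : Ω → ℕ) (b : ℝ) (ω : Ω) : ℝ :=
  ∫ t in (V 0 ω)..(max (b - (∫ ω', V 0 ω' ∂Q) / (1 - α)) (V 0 ω) + delaySum V M ω), t

/-- `max(b - Y, E[Y]/(1-α))`. -/
def epochLength (Q : Measure Ω) (α : ℝ) (V : ℕ → Ω → ℝ) (b : ℝ) (ω : Ω) : ℝ :=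
  max (b - V 0 ω) ((∫ ω', V 0 ω' ∂Q) / (1 - α))

/-- Left-hand side of the equation for `β`. -/
def rootFun (Q : Measure Ω) (α : ℝ) (V : ℕ → Ω → ℝ) (M : Ω → ℕ) (b : ℝ) : ℝ :=
  (∫ ω, epochCost Q α V M b ω ∂Q) - b * ∫ ω, epochLength Q α V b ω ∂Q

end Sampling

end

/-!
The average age is treated as a Markov decision problem and solved by verification with an explicit
value function.

Write `μ = E[Y] / (1 - α)` for the mean of the geometric sum of delays, `β = v + μ`, and charge cost
at rate `Δ_t - β`. If the age at a feedback time is `a`, the optimal remaining cost is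
`G a - (a ^ 2 / 2 - β * a)` with `G x = g + ((x - v)⁺) ^ 2 / 2` (`potential`), provided that
`G a ≤ (1 - α) E[(x + Y) ^ 2 / 2 - β (x + Y)] + α E[G (x + Y)]` whenever the next sample is sent at age
`x ≥ a`, with equality for `x = max a v`, and that `E[G Y - (Y ^ 2 / 2 - β Y)] = 0`. The constant `g`
is determined by the optimality equation at `x = v`, and the last condition is then exactly the
equation for `β` (`exists_isOptimalPotential`). The inequality (`IsOptimalPotential.le_integral`)
follows by replacing the convex function `G` by a tangent.

Consequently the accumulated cost plus potential has nonnegative drift under every causal policy, and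
zero drift under the threshold rule: the transmission outcome is independent of the history and is
integrated out first (`IsUnreliableChannel.integral_stoppedIncrement`). To evaluate at a fixed time
`T`, only transmissions started before `T` are counted; their number is at most `T / ε + 1`, and all
quantities involved are bounded by `T` and the squares of the delays, so no integrability of the
policy is needed. The period that is incomplete at time `T` costs an error of the order of the age at
time `T` and of the square of one delay. The square of the age is at most twice the accumulated age,
and the expected maximal squared delay is `o(T)` by truncation; both errors are negligible
(`IsFeasibleAt.le_integral_age`, `IsFeasibleAt.integral_age_le`). This gives
`IsUnreliableChannel.le_avgAge` and `IsUnreliableChannel.avgAge_le`.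

The mean square error equals the average age for every policy independent of the signal
(`IsSignalAgnostic.avgMSE_eq_avgAge`): the Brownian motion is replaced by a random continuous path,
which makes evaluation at a random time jointly measurable, and Fubini's theorem reduces the claim to
`E[(W_t - W_s) ^ 2] = t - s`.

The left-hand side of the equation for `β` is computed from the first two moments of the geometric sum
(`IsEpochSample.moments`); it is continuous and decreases at rate at least `μ`, hence has exactly one
root (`exists_unique_root`).
-/

noncomputable section

namespace Sampling

/-! ### Sample paths -/

section

variable {Ω : Type*}

/-- Generation time of the freshest sample known at the `i`-th feedback time, that is, of the last
successful one among the transmissions `0, …, i - 1` (`0` if there is none). -/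
def lastFresh (S : ℕ → Ω → ℝ) (C : ℕ → Ω → Bool) : ℕ → Ω → ℝ
  | 0 => fun _ => 0
  | i + 1 => fun ω => if C i ω = true then S i ω else lastFresh S C i ω

/-- The condition, on a single sample path, that samples are generated after the feedback on the
preceding one and that transmission times are at least `ε`. -/
structure IsFeasibleAt (S Y : ℕ → Ω → ℝ) (ε : ℝ) (ω : Ω) : Prop where
  pos : 0 < ε
  feasible : ∀ i, feedback S Y i ω ≤ S i ω
  delay_ge : ∀ i, ε ≤ Y i ω

section Path

variable {S Y : ℕ → Ω → ℝ} {C : ℕ → Ω → Bool} {ε : ℝ} {ω : Ω}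

lemma IsFeasibleAt.feedback_add_le (h : IsFeasibleAt S Y ε ω) (i : ℕ) :
    feedback S Y i ω + ε ≤ feedback S Y (i + 1) ω :=
  add_le_add (h.feasible i) (h.delay_ge i)

lemma IsFeasibleAt.sample_lt (h : IsFeasibleAt S Y ε ω) (i : ℕ) :
    S i ω < feedback S Y (i + 1) ω := by
  have := h.delay_ge i
  have := h.pos
  simp only [feedback]
  linarith

lemma IsFeasibleAt.feedback_mono (h : IsFeasibleAt S Y ε ω) :
    Monotone fun i => feedback S Y i ω :=
  monotone_nat_of_le_succ fun i => by linarith [h.feedback_add_le i, h.pos]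

lemma IsFeasibleAt.mul_le_feedback (h : IsFeasibleAt S Y ε ω) (i : ℕ) :
    i * ε ≤ feedback S Y i ω := by
  induction i with
  | zero => simp [feedback]
  | succ i ih => push_cast; linarith [h.feedback_add_le i]

lemma IsFeasibleAt.feedback_nonneg (h : IsFeasibleAt S Y ε ω) (i : ℕ) :
    0 ≤ feedback S Y i ω :=
  (mul_nonneg i.cast_nonneg h.pos.le).trans (h.mul_le_feedback i)

lemma IsFeasibleAt.lastFresh_nonneg (h : IsFeasibleAt S Y ε ω) (i : ℕ) :
    0 ≤ lastFresh S C i ω := by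
  induction i with
  | zero => simp [lastFresh]
  | succ i ih =>
    simp only [lastFresh]
    split_ifs
    · exact (h.feedback_nonneg i).trans (h.feasible i)
    · exact ih

lemma IsFeasibleAt.lastFresh_le_feedback (h : IsFeasibleAt S Y ε ω) (i : ℕ) :
    lastFresh S C i ω ≤ feedback S Y i ω := by
  induction i with
  | zero => simp [lastFresh, feedback]
  | succ i ih =>
    have := h.feasible i
    have := h.sample_lt i
    simp only [lastFresh]
    split_ifs <;> linarith

lemma IsFeasibleAt.sample_le_lastFresh (h : IsFeasibleAt S Y ε ω) {i n : ℕ} (hin : i < n)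
    (hC : C i ω = true) : S i ω ≤ lastFresh S C n ω := by
  induction n with
  | zero => omega
  | succ n ih =>
    rcases Nat.lt_succ_iff_lt_or_eq.1 hin with hlt | rfl
    · have h1 := ih hlt
      have := h.lastFresh_le_feedback (C := C) n
      have := h.feasible n
      simp only [lastFresh]
      split_ifs <;> linarith
    · simp [lastFresh, hC]

lemma lastFresh_eq (n : ℕ) :
    lastFresh S C n ω = 0 ∨ ∃ i < n, C i ω = true ∧ lastFresh S C n ω = S i ω := by
  induction n with
  | zero => simp [lastFresh]
  | succ n ih =>
    by_cases hC : C n ω = true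
    · exact Or.inr ⟨n, n.lt_succ_self, hC, by simp [lastFresh, hC]⟩
    · simp only [lastFresh, hC]
      rcases ih with h | ⟨i, hi, h⟩
      · exact Or.inl h
      · exact Or.inr ⟨i, hi.trans n.lt_succ_self, h⟩

lemma IsFeasibleAt.freshest_eq (h : IsFeasibleAt S Y ε ω) {n : ℕ} {t : ℝ}
    (h₁ : feedback S Y n ω ≤ t) (h₂ : t < feedback S Y (n + 1) ω) :
    freshest S Y C t ω = lastFresh S C n ω := by
  refine IsGreatest.csSup_eq ⟨?_, ?_⟩
  · rcases lastFresh_eq (S := S) (C := C) (ω := ω) n with h0 | ⟨i, hi, hC, hi'⟩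
    · exact Or.inl h0
    · exact Or.inr ⟨i, hC, (h.feedback_mono (Nat.succ_le_of_lt hi)).trans h₁, hi'⟩
  · rintro s (rfl | ⟨i, hC, hi, rfl⟩)
    · exact h.lastFresh_nonneg n
    · refine h.sample_le_lastFresh ?_ hC
      by_contra! hni
      have : feedback S Y (n + 1) ω ≤ S i ω + Y i ω := h.feedback_mono (Nat.succ_le_succ hni)
      linarith

lemma IsFeasibleAt.age_eq (h : IsFeasibleAt S Y ε ω) {n : ℕ} {t : ℝ}
    (h₁ : feedback S Y n ω ≤ t) (h₂ : t < feedback S Y (n + 1) ω) :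
    age S Y C t ω = t - lastFresh S C n ω := by
  rw [age, h.freshest_eq h₁ h₂]

/-- Every time lies in the period between two successive feedback times. -/
lemma IsFeasibleAt.exists_feedback_le_lt (h : IsFeasibleAt S Y ε ω) {t : ℝ} (ht : 0 ≤ t) :
    ∃ n : ℕ, feedback S Y n ω ≤ t ∧ t < feedback S Y (n + 1) ω := by
  have hex : ∃ n : ℕ, t < feedback S Y n ω := by
    obtain ⟨n, hn⟩ := exists_nat_gt (t / ε)
    exact ⟨n, ((div_lt_iff₀ h.pos).1 hn).trans_le (h.mul_le_feedback n)⟩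
  classical
  have hf := Nat.find_spec hex
  obtain ⟨n, hn⟩ : ∃ n, Nat.find hex = n + 1 := by
    refine Nat.exists_eq_succ_of_ne_zero fun h0 => ?_
    rw [h0] at hf
    exact absurd hf (by simpa [feedback] using ht)
  refine ⟨n, not_lt.1 (Nat.find_min hex (by omega)), hn ▸ hf⟩

lemma IsFeasibleAt.freshest_nonneg (h : IsFeasibleAt S Y ε ω) {t : ℝ} (ht : 0 ≤ t) :
    0 ≤ freshest S Y C t ω := by
  obtain ⟨n, h₁, h₂⟩ := h.exists_feedback_le_lt ht
  rw [h.freshest_eq h₁ h₂]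
  exact h.lastFresh_nonneg n

lemma IsFeasibleAt.age_nonneg (h : IsFeasibleAt S Y ε ω) {t : ℝ} (ht : 0 ≤ t) :
    0 ≤ age S Y C t ω := by
  obtain ⟨n, h₁, h₂⟩ := h.exists_feedback_le_lt ht
  rw [h.age_eq h₁ h₂]
  linarith [h.lastFresh_le_feedback (C := C) n]

lemma IsFeasibleAt.age_le (h : IsFeasibleAt S Y ε ω) {t : ℝ} (ht : 0 ≤ t) :
    age S Y C t ω ≤ t := by
  linarith [h.freshest_nonneg (C := C) ht, show age S Y C t ω = t - freshest S Y C t ω from rfl]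

/-- Contribution of transmission `i` to the process "accumulated cost plus potential", when the cost
rate is `Δ_t - β` and `G (a) - (a ^ 2 / 2 - β * a)` is the potential of a feedback time at which the
age is `a`. -/
def increment (S Y : ℕ → Ω → ℝ) (C : ℕ → Ω → Bool) (β : ℝ) (G : ℝ → ℝ) (i : ℕ) (ω : Ω) : ℝ :=
  (feedback S Y (i + 1) ω - lastFresh S C i ω) ^ 2 / 2
    - β * (feedback S Y (i + 1) ω - lastFresh S C i ω)
    + (G (feedback S Y (i + 1) ω - lastFresh S C (i + 1) ω)
      - ((feedback S Y (i + 1) ω - lastFresh S C (i + 1) ω) ^ 2 / 2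
        - β * (feedback S Y (i + 1) ω - lastFresh S C (i + 1) ω)))
    - G (feedback S Y i ω - lastFresh S C i ω)

/-- The age is piecewise affine, so its integral is explicit; the sum of squares telescopes into the
increments. -/
lemma IsFeasibleAt.integral_age (h : IsFeasibleAt S Y ε ω) (β : ℝ) (G : ℝ → ℝ) (n : ℕ) {T : ℝ}
    (h₁ : feedback S Y n ω ≤ T) (h₂ : T ≤ feedback S Y (n + 1) ω) :
    IntervalIntegrable (fun t => age S Y C t ω) volume 0 T ∧
    ∫ t in (0 : ℝ)..T, age S Y C t ω = β * T + G 0 +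
      ∑ i ∈ Finset.range n, increment S Y C β G i ω - G (feedback S Y n ω - lastFresh S C n ω) +
      ((T - lastFresh S C n ω) ^ 2 / 2 - β * (T - lastFresh S C n ω)) := by
  -- the last, incomplete period
  have key : ∀ (n : ℕ) (T : ℝ), feedback S Y n ω ≤ T → T ≤ feedback S Y (n + 1) ω →
      IntervalIntegrable (fun t => age S Y C t ω) volume (feedback S Y n ω) T ∧
      ∫ t in (feedback S Y n ω)..T, age S Y C t ω =
        (T - lastFresh S C n ω) ^ 2 / 2 - (feedback S Y n ω - lastFresh S C n ω) ^ 2 / 2 := by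
    intro n T h₁ h₂
    have hae : ∀ᵐ t ∂volume, t ∈ Set.uIoc (feedback S Y n ω) T →
        t - lastFresh S C n ω = age S Y C t ω := by
      have : ∀ᵐ t ∂(volume : Measure ℝ), t ≠ feedback S Y (n + 1) ω := by
        simp [ae_iff]
      filter_upwards [this] with t ht hmem
      rw [Set.uIoc_of_le h₁] at hmem
      exact (h.age_eq hmem.1.le (lt_of_le_of_ne (hmem.2.trans h₂) ht)).symm
    constructor
    · refine IntervalIntegrable.congr_ae ?_ ((ae_restrict_iff' measurableSet_uIoc).2 hae)
      exact (by fun_prop : Continuous fun t : ℝ => t - lastFresh S C n ω).intervalIntegrable _ _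
    · rw [← intervalIntegral.integral_congr_ae hae,
        intervalIntegral.integral_comp_sub_right (fun t => t), integral_id]
      ring
  induction n generalizing T with
  | zero =>
    have := key 0 T h₁ h₂
    simp only [feedback, lastFresh] at this ⊢
    refine ⟨this.1, ?_⟩
    rw [this.2]
    simp
  | succ n ih =>
    have hn := ih (h.feedback_mono n.le_succ) le_rfl
    have hT := key (n + 1) T h₁ h₂
    refine ⟨hn.1.trans hT.1, ?_⟩
    rw [← intervalIntegral.integral_add_adjacent_intervals hn.1 hT.1, hn.2, hT.2,
      Finset.sum_range_succ, increment]
    ring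

/-- The age grows at unit rate, hence reaching `x` requires an accumulated age of `x ^ 2 / 2`. -/
lemma IsFeasibleAt.sq_age_le (h : IsFeasibleAt S Y ε ω) {T : ℝ} (hT : 0 ≤ T) :
    age S Y C T ω ^ 2 / 2 ≤ ∫ t in (0 : ℝ)..T, age S Y C t ω := by
  obtain ⟨n, h₁, h₂⟩ := h.exists_feedback_le_lt hT
  have hint := (h.integral_age (C := C) 0 0 n h₁ h₂.le).1
  have hu := h.freshest_nonneg (C := C) hT
  have hle : freshest S Y C T ω ≤ T := by
    have := h.age_nonneg (C := C) hT
    rw [age] at this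
    linarith
  have hint₁ : IntervalIntegrable (fun t => age S Y C t ω) volume 0 (freshest S Y C T ω) :=
    hint.mono_set (by rw [Set.uIcc_of_le hu, Set.uIcc_of_le hT]; exact Set.Icc_subset_Icc_right hle)
  have hint₂ : IntervalIntegrable (fun t => age S Y C t ω) volume (freshest S Y C T ω) T :=
    hint.mono_set (by rw [Set.uIcc_of_le hle, Set.uIcc_of_le hT]; exact Set.Icc_subset_Icc_left hu)
  rw [← intervalIntegral.integral_add_adjacent_intervals hint₁ hint₂]
  have h0 : 0 ≤ ∫ t in (0 : ℝ)..(freshest S Y C T ω), age S Y C t ω :=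
    intervalIntegral.integral_nonneg hu fun t ht => h.age_nonneg ht.1
  have h1 : ∫ t in (freshest S Y C T ω)..T, (t - freshest S Y C T ω) ≤
      ∫ t in (freshest S Y C T ω)..T, age S Y C t ω := by
    refine intervalIntegral.integral_mono_on hle
      ((by fun_prop : Continuous fun t : ℝ => t - freshest S Y C T ω).intervalIntegrable _ _)
      hint₂ fun t ht => ?_
    rw [age]
    have ht0 : 0 ≤ t := hu.trans ht.1
    obtain ⟨k, hk₁, hk₂⟩ := h.exists_feedback_le_lt ht0
    have : freshest S Y C t ω ≤ freshest S Y C T ω := by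
      rw [h.freshest_eq hk₁ hk₂]
      rcases lastFresh_eq (S := S) (C := C) (ω := ω) k with h0 | ⟨i, hi, hC, hi'⟩
      · rw [h0]; exact hu
      · rw [hi', h.freshest_eq h₁ h₂]
        refine h.sample_le_lastFresh ?_ hC
        by_contra! hni
        have : feedback S Y (n + 1) ω ≤ feedback S Y k ω := h.feedback_mono (by omega)
        linarith [ht.2]
    linarith
  rw [intervalIntegral.integral_comp_sub_right (fun t => t), integral_id] at h1
  rw [show age S Y C T ω = T - freshest S Y C T ω from rfl]
  linarith

/-- Only the transmissions started before time `T` contribute to the cost up to `T`. -/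
lemma IsFeasibleAt.sum_increment_eq (h : IsFeasibleAt S Y ε ω) (D : ℕ → ℝ) {n K : ℕ} {T : ℝ}
    (h₁ : feedback S Y n ω ≤ T) (h₂ : T < feedback S Y (n + 1) ω) (hK : n < K) :
    ∑ i ∈ Finset.range K, (if S i ω < T then D i else 0) =
      ∑ i ∈ Finset.range n, D i + if S n ω < T then D n else 0 := by
  rw [← Finset.sum_range_add_sum_Ico _ (Nat.succ_le_of_lt hK), Finset.sum_range_succ]
  rw [Finset.sum_eq_zero (s := Finset.Ico (n + 1) K), add_zero]
  · congr 1
    refine Finset.sum_congr rfl fun i hi => if_pos ?_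
    exact (h.sample_lt i).trans_le
      ((h.feedback_mono (Nat.succ_le_of_lt (Finset.mem_range.1 hi))).trans h₁)
  · intro i hi
    refine if_neg (not_lt.2 ?_)
    exact h₂.le.trans ((h.feedback_mono (Finset.mem_Ico.1 hi).1).trans (h.feasible i))

end Path

end

/-! ### The potential and the cost up to a fixed time -/

section

variable {Ω : Type*}

/-- The potential `G`: constant up to the threshold `v` and quadratic beyond it. It is the value
function of the problem, up to the cost `x ^ 2 / 2 - β * x` of the current age `x`. -/
def potential (v g x : ℝ) : ℝ := g + (max (x - v) 0) ^ 2 / 2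

lemma potential_mono (v g : ℝ) : Monotone (potential v g) := fun x y hxy => by
  have : max (x - v) 0 ≤ max (y - v) 0 := max_le_max (by linarith) le_rfl
  have := pow_le_pow_left₀ (le_max_right _ _) this 2
  simp only [potential]
  linarith

lemma potential_sub_le (v μ g : ℝ) {x : ℝ} :
    potential v g x - (x ^ 2 / 2 - (v + μ) * x) ≤ g + v ^ 2 / 2 + μ * x := by
  simp only [potential]
  rcases max_cases (x - v) 0 with ⟨h, _⟩ | ⟨h, _⟩ <;> rw [h] <;> nlinarith [sq_nonneg (x - v)]

lemma le_potential_sub {v μ : ℝ} (g : ℝ) (hμ : 0 ≤ μ) {x : ℝ} (hx : 0 ≤ x) :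
    g ≤ potential v g x - (x ^ 2 / 2 - (v + μ) * x) := by
  have h0 := mul_nonneg hμ hx
  simp only [potential]
  rcases max_cases (x - v) 0 with ⟨h, h'⟩ | ⟨h, h'⟩ <;> rw [h]
  · nlinarith [sq_nonneg v]
  · nlinarith

section Path

variable {S Y : ℕ → Ω → ℝ} {C : ℕ → Ω → Bool} {ε : ℝ} {ω : Ω}

/-- A bound on the square of any of the first `K` delays which does not depend on its index and whose
expectation is small compared to `K`. -/
lemma sq_le_truncation {Y : ℕ → Ω → ℝ} {ω : Ω} (L : ℝ) {n K : ℕ} (hn : n < K) :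
    Y n ω ^ 2 ≤ L + ∑ i ∈ Finset.range K, max (Y i ω ^ 2 - L) 0 := by
  have h := Finset.single_le_sum (f := fun i => max (Y i ω ^ 2 - L) 0)
    (fun i _ => le_max_right _ _) (Finset.mem_range.2 hn)
  have := le_max_left (Y n ω ^ 2 - L) 0
  linarith

lemma IsFeasibleAt.lt_of_lt_mul (h : IsFeasibleAt S Y ε ω) {T : ℝ} {n K : ℕ}
    (hn : feedback S Y n ω ≤ T) (hK : T < K * ε) : n < K := by
  have := (h.mul_le_feedback n).trans_lt (hn.trans_lt hK)
  exact_mod_cast lt_of_mul_lt_mul_right this h.pos.le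

/-- The accumulated cost up to a fixed time `T` dominates the increments of the transmissions
started before `T`, up to the effect of the period that is incomplete at time `T`. The age at time
`T` is absorbed by a small multiple of the accumulated age, and the delay of the transmission in
progress by the truncation level `L` and the excess of all delays over it. -/
lemma IsFeasibleAt.le_integral_age (h : IsFeasibleAt S Y ε ω) {v μ : ℝ} (g : ℝ) (hμ : 0 ≤ μ)
    (hβ : 0 ≤ v + μ) {δ : ℝ} (hδ : 0 < δ) (L : ℝ) {T : ℝ} (hT : 0 ≤ T) {K : ℕ} (hK : T < K * ε) :
    (v + μ) * T + ∑ i ∈ Finset.range K,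
        (if S i ω < T then increment S Y C (v + μ) (potential v g) i ω else 0)
      - (g + v ^ 2 / 2 - potential v g 0 + μ ^ 2 / (4 * δ) + μ ^ 2)
      - (1 / (4 * δ) + 2) * (L + ∑ i ∈ Finset.range K, max (Y i ω ^ 2 - L) 0)
    ≤ (1 + 4 * δ) * ∫ t in (0 : ℝ)..T, age S Y C t ω := by
  obtain ⟨n, h₁, h₂⟩ := h.exists_feedback_le_lt hT
  have hnK := h.lt_of_lt_mul h₁ hK
  have hJ := (h.integral_age (C := C) (v + μ) (potential v g) n h₁ h₂.le).2
  have hsq := h.sq_age_le (C := C) hT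
  rw [h.age_eq h₁ h₂] at hsq
  rw [h.sum_increment_eq (fun i => increment S Y C (v + μ) (potential v g) i ω) h₁ h₂ hnK]
  have hY := sq_le_truncation (Y := Y) (ω := ω) L hnK
  set J := ∫ t in (0 : ℝ)..T, age S Y C t ω
  set R := L + ∑ i ∈ Finset.range K, max (Y i ω ^ 2 - L) 0
  set x := T - lastFresh S C n ω with hx
  have hu := h.lastFresh_le_feedback (C := C) n
  have hx0 : 0 ≤ x := by linarith
  have hy0 : 0 < Y n ω := h.pos.trans_le (h.delay_ge n)
  have e1 : μ * x ≤ δ * x ^ 2 + μ ^ 2 / (4 * δ) := by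
    have : δ * x ^ 2 + μ ^ 2 / (4 * δ) - μ * x = (2 * δ * x - μ) ^ 2 / (4 * δ) := by
      field_simp; ring
    have : 0 ≤ (2 * δ * x - μ) ^ 2 / (4 * δ) := by positivity
    linarith
  have e2 : x * Y n ω ≤ δ * x ^ 2 + Y n ω ^ 2 / (4 * δ) := by
    have : δ * x ^ 2 + Y n ω ^ 2 / (4 * δ) - x * Y n ω = (2 * δ * x - Y n ω) ^ 2 / (4 * δ) := by
      field_simp; ring
    have : 0 ≤ (2 * δ * x - Y n ω) ^ 2 / (4 * δ) := by positivity
    linarith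
  have e3 : μ * Y n ω ≤ μ ^ 2 + Y n ω ^ 2 := by nlinarith [sq_nonneg (μ - Y n ω)]
  have e4 : (1 / (4 * δ) + 2) * Y n ω ^ 2 ≤ (1 / (4 * δ) + 2) * R :=
    mul_le_mul_of_nonneg_left hY (by positivity)
  have e4' : (1 / (4 * δ) + 2) * Y n ω ^ 2 = Y n ω ^ 2 / (4 * δ) + 2 * Y n ω ^ 2 := by ring
  have e5 : δ * x ^ 2 ≤ δ * (2 * J) := mul_le_mul_of_nonneg_left (by linarith) hδ.le
  have e6 : 0 ≤ Y n ω ^ 2 / (4 * δ) := by positivity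
  suffices hmain : (v + μ) * T + (∑ i ∈ Finset.range n, increment S Y C (v + μ) (potential v g) i ω
      + if S n ω < T then increment S Y C (v + μ) (potential v g) n ω else 0)
      + potential v g 0 - (g + v ^ 2 / 2) - μ * x - (μ * Y n ω + x * Y n ω + Y n ω ^ 2 / 2) ≤ J by
    nlinarith
  rw [hJ]
  split_ifs with hS
  · -- a transmission is in progress at time `T`
    have hA0 : potential v g (feedback S Y (n + 1) ω - lastFresh S C (n + 1) ω)
        - ((feedback S Y (n + 1) ω - lastFresh S C (n + 1) ω) ^ 2 / 2
        - (v + μ) * (feedback S Y (n + 1) ω - lastFresh S C (n + 1) ω))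
        ≤ g + v ^ 2 / 2 + μ * (x + Y n ω) := by
      refine (potential_sub_le v μ g).trans ?_
      have : feedback S Y (n + 1) ω - lastFresh S C (n + 1) ω ≤ x + Y n ω := by
        simp only [feedback, lastFresh]
        split_ifs <;> linarith
      linarith [mul_le_mul_of_nonneg_left this hμ]
    have hy1 : feedback S Y (n + 1) ω - lastFresh S C n ω ≤ x + Y n ω := by
      simp only [feedback]; linarith
    have hy2 : x ≤ feedback S Y (n + 1) ω - lastFresh S C n ω := by linarith
    rw [increment]
    have hb := mul_le_mul_of_nonneg_left hy2 hβ
    have hs := pow_le_pow_left₀ (hx0.trans hy2) hy1 2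
    linarith
  · -- no transmission is in progress at time `T`
    have hG := potential_mono v g (show feedback S Y n ω - lastFresh S C n ω ≤ x by linarith)
    have hh := potential_sub_le v μ g (x := x)
    have := mul_nonneg hμ hy0.le
    have := mul_nonneg hx0 hy0.le
    nlinarith [sq_nonneg (Y n ω)]

/-- For the threshold rule the potential does not change during a waiting time, which gives the
converse of `IsFeasibleAt.le_integral_age`. -/
lemma IsFeasibleAt.integral_age_le (h : IsFeasibleAt S Y ε ω) {v μ : ℝ} (g : ℝ) (hμ : 0 ≤ μ)
    (hβ : 0 ≤ v + μ) (hS : ∀ i, S i ω = max (feedback S Y i ω) (v + lastFresh S C i ω))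
    (L : ℝ) {T : ℝ} (hT : 0 ≤ T) {K : ℕ} (hK : T < K * ε) :
    ∫ t in (0 : ℝ)..T, age S Y C t ω ≤ (v + μ) * T + ∑ i ∈ Finset.range K,
        (if S i ω < T then increment S Y C (v + μ) (potential v g) i ω else 0)
      + (potential v g 0 - g + (v + μ))
      + (v + μ) * (L + ∑ i ∈ Finset.range K, max (Y i ω ^ 2 - L) 0) := by
  obtain ⟨n, h₁, h₂⟩ := h.exists_feedback_le_lt hT
  have hnK := h.lt_of_lt_mul h₁ hK
  rw [(h.integral_age (C := C) (v + μ) (potential v g) n h₁ h₂.le).2,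
    h.sum_increment_eq (fun i => increment S Y C (v + μ) (potential v g) i ω) h₁ h₂ hnK]
  have hY := mul_le_mul_of_nonneg_left (sq_le_truncation (Y := Y) (ω := ω) L hnK) hβ
  set R := L + ∑ i ∈ Finset.range K, max (Y i ω ^ 2 - L) 0
  set x := T - lastFresh S C n ω with hx
  have hu := h.lastFresh_le_feedback (C := C) n
  have hx0 : 0 ≤ x := by linarith
  have hY' : (v + μ) * Y n ω ≤ (v + μ) + (v + μ) * Y n ω ^ 2 := by
    nlinarith [sq_nonneg (Y n ω - 1), mul_nonneg hβ (sq_nonneg (Y n ω - 1)),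
      mul_nonneg hβ (sq_nonneg (Y n ω))]
  split_ifs with hST
  · have hA0 : g ≤ potential v g (feedback S Y (n + 1) ω - lastFresh S C (n + 1) ω)
        - ((feedback S Y (n + 1) ω - lastFresh S C (n + 1) ω) ^ 2 / 2
        - (v + μ) * (feedback S Y (n + 1) ω - lastFresh S C (n + 1) ω)) :=
      le_potential_sub g hμ (by linarith [h.lastFresh_le_feedback (C := C) (n + 1)])
    have hy1 : feedback S Y (n + 1) ω - lastFresh S C n ω ≤ x + Y n ω := by
      simp only [feedback]; linarith
    have hy2 : x ≤ feedback S Y (n + 1) ω - lastFresh S C n ω := by linarith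
    have hb := mul_le_mul_of_nonneg_left hy1 hβ
    have hs := pow_le_pow_left₀ hx0 hy2 2
    rw [increment]
    linarith
  · have hG : potential v g x = potential v g (feedback S Y n ω - lastFresh S C n ω) := by
      rw [hS n] at hST
      rcases le_total (feedback S Y n ω) (v + lastFresh S C n ω) with hle | hle
      · rw [max_eq_right hle] at hST
        simp only [potential]
        rw [max_eq_right (by linarith), max_eq_right (by linarith)]
      · rw [max_eq_left hle] at hST
        rw [hx, le_antisymm (not_lt.1 hST) h₁]
    have hh := le_potential_sub (v := v) g hμ hx0
    have := mul_nonneg hβ (sq_nonneg (Y n ω))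
    linarith

end Path

end

/-! ### Independence of the history and the transmissions -/

section

/-- The feedback time, the sampling time and the generation time of the freshest sample are
determined by the timing history. -/
lemma measurable_state_history {Ω : Type*} {S Y : ℕ → Ω → ℝ} {C : ℕ → Ω → Bool} (i : ℕ) :
    Measurable[MeasurableSpace.comap (history S Y C i) inferInstance]
      (fun ω => (feedback S Y i ω, S i ω, lastFresh S C i ω)) := by
  let m : MeasurableSpace Ω := MeasurableSpace.comap (history S Y C i) inferInstance
  have hh : Measurable[m] (history S Y C i) := comap_measurable _
  have hS : ∀ j ≤ i, Measurable[m] (S j) := fun j hj =>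
    ((measurable_pi_apply (⟨j, Nat.lt_succ_of_le hj⟩ : Fin (i + 1))).comp measurable_fst).comp hh
  have hYC : ∀ j < i, Measurable[m] (fun ω => (Y j ω, C j ω)) := fun j hj =>
    ((measurable_pi_apply (⟨j, hj⟩ : Fin i)).comp measurable_snd).comp hh
  have hF : Measurable[m] (feedback S Y i) := by
    cases i with
    | zero => exact measurable_const
    | succ j => exact (hS j j.le_succ).add (measurable_fst.comp (hYC j j.lt_succ_self))
  have hU : ∀ j ≤ i, Measurable[m] (lastFresh S C j) := by
    intro j hj
    induction j with
    | zero => exact measurable_const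
    | succ j ih =>
      exact Measurable.ite ((measurable_snd.comp (hYC j hj)) (measurableSet_singleton true))
        (hS j (by omega)) (ih (by omega))
  exact hF.prodMk ((hS i le_rfl).prodMk (hU i le_rfl))

variable {Ω : Type*} [MeasurableSpace Ω] {P : Measure Ω}

lemma integral_comp_of_indepFun [IsProbabilityMeasure P] {A B : Type*} [MeasurableSpace A]
    [MeasurableSpace B] {X : Ω → A} {Z : Ω → B} (hX : Measurable X) (hZ : Measurable Z)
    (hXZ : IndepFun X Z P) {f : A × B → ℝ} (hf : Measurable f)
    (hint : Integrable (fun ω => f (X ω, Z ω)) P) :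
    ∫ ω, f (X ω, Z ω) ∂P = ∫ ω, ∫ ω', f (X ω, Z ω') ∂P ∂P := by
  have hmap := (indepFun_iff_map_prod_eq_prod_map_map hX.aemeasurable hZ.aemeasurable).1 hXZ
  have := Measure.isProbabilityMeasure_map (μ := P) hX.aemeasurable
  have := Measure.isProbabilityMeasure_map (μ := P) hZ.aemeasurable
  have hint' : Integrable f ((P.map X).prod (P.map Z)) := by
    rw [← hmap]
    exact (integrable_map_measure hf.aestronglyMeasurable (hX.prodMk hZ).aemeasurable).2 hint
  rw [← integral_map (hX.prodMk hZ).aemeasurable (f := f) hf.aestronglyMeasurable, hmap,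
    integral_prod _ hint', integral_map hX.aemeasurable
      hf.stronglyMeasurable.integral_prod_right'.aestronglyMeasurable]
  refine integral_congr_ae (Eventually.of_forall fun ω => ?_)
  exact integral_map hZ.aemeasurable
    (hf.comp (measurable_const.prodMk measurable_id)).aestronglyMeasurable

section Channel

variable {α : ℝ} {Y : ℕ → Ω → ℝ} {C : ℕ → Ω → Bool}

lemma IsUnreliableChannel.integral_comp_delay (h : IsUnreliableChannel P α Y C) {f : ℝ → ℝ}
    (hf : Measurable f) (i : ℕ) : ∫ ω, f (Y i ω) ∂P = ∫ ω, f (Y 0 ω) ∂P :=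
  ((h.identDistrib_delay i).comp hf).integral_eq

lemma IsUnreliableChannel.integrable_comp_delay (h : IsUnreliableChannel P α Y C) {f : ℝ → ℝ}
    (hf : Measurable f) (hint : Integrable (fun ω => f (Y 0 ω)) P) (i : ℕ) :
    Integrable (fun ω => f (Y i ω)) P :=
  ((h.identDistrib_delay i).comp hf).integrable_iff.2 hint

lemma IsUnreliableChannel.integral_ite [IsProbabilityMeasure P]
    (h : IsUnreliableChannel P α Y C) (hα : 0 ≤ α) {f₁ f₂ : ℝ → ℝ} (hf₁ : Measurable f₁)
    (hf₂ : Measurable f₂) (hi₁ : Integrable (fun ω => f₁ (Y 0 ω)) P)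
    (hi₂ : Integrable (fun ω => f₂ (Y 0 ω)) P) (i : ℕ) :
    ∫ ω, (if C i ω = true then f₁ (Y i ω) else f₂ (Y i ω)) ∂P =
      (1 - α) * ∫ ω, f₁ (Y 0 ω) ∂P + α * ∫ ω, f₂ (Y 0 ω) ∂P := by
  have hms : ∀ b : Bool, MeasurableSet {ω | C i ω = b} := fun b =>
    h.measurable_state i (measurableSet_singleton b)
  have hF : P.real {ω | C i ω = false} = α := by
    rw [measureReal_def, h.prob_failure, ENNReal.toReal_ofReal hα]
  have hT : P.real {ω | C i ω = true} = 1 - α := by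
    rw [← hF, ← probReal_compl_eq_one_sub (hms false)]
    congr 1
    ext ω
    simp
  have key : ∀ (b : Bool) (f : ℝ → ℝ), Measurable f → Integrable (fun ω => f (Y 0 ω)) P →
      Integrable (fun ω => (if C i ω = b then (1 : ℝ) else 0) * f (Y i ω)) P ∧
      ∫ ω, (if C i ω = b then (1 : ℝ) else 0) * f (Y i ω) ∂P =
        P.real {ω | C i ω = b} * ∫ ω, f (Y 0 ω) ∂P := by
    intro b f hf hi
    have hmb : Measurable fun c : Bool => if c = b then (1 : ℝ) else 0 := measurable_of_finite _
    have hind : IndepFun (fun ω => if C i ω = b then (1 : ℝ) else 0) (fun ω => f (Y i ω)) P :=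
      (h.indepFun_delay_state i).symm.comp hmb hf
    have hI : (fun ω => if C i ω = b then (1 : ℝ) else 0) = {ω | C i ω = b}.indicator 1 := by
      ext ω
      simp [Set.indicator_apply]
    have hi1 : Integrable (fun ω => if C i ω = b then (1 : ℝ) else 0) P := by
      rw [hI]
      exact (integrable_const (1 : ℝ)).indicator (hms b)
    have hi2 := h.integrable_comp_delay hf hi i
    refine ⟨hind.integrable_mul hi1 hi2, ?_⟩
    refine (hind.integral_fun_mul_eq_mul_integral hi1.aestronglyMeasurable
      hi2.aestronglyMeasurable).trans ?_
    rw [h.integral_comp_delay hf, hI, integral_indicator_one (hms b)]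
  rw [← hT, ← hF, ← (key true f₁ hf₁ hi₁).2, ← (key false f₂ hf₂ hi₂).2,
    ← integral_add (key true f₁ hf₁ hi₁).1 (key false f₂ hf₂ hi₂).1]
  refine integral_congr_ae (Eventually.of_forall fun ω => ?_)
  cases hc : C i ω <;> simp [hc]

end Channel

section Policy

variable {Y S : ℕ → Ω → ℝ} {C : ℕ → Ω → Bool}

lemma indepFun_state_transmission
    (hcausal : ∀ i, IndepFun (history S Y C i) (fun ω (k : ℕ) => (Y (i + k) ω, C (i + k) ω)) P)
    (i : ℕ) :
    IndepFun (fun ω => (feedback S Y i ω, S i ω, lastFresh S C i ω))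
      (fun ω => (Y i ω, C i ω)) P := by
  have hm : Measurable fun z : ℕ → ℝ × Bool => z 0 := measurable_pi_apply 0
  have h0 := (hcausal i).comp measurable_id hm
  rw [IndepFun_iff_Indep] at h0 ⊢
  exact indep_of_indep_of_le_left h0 (measurable_state_history i).comap_le

end Policy

end

/-! ### The optimality equation -/

section

variable {Ω : Type*} [MeasurableSpace Ω] {P : Measure Ω}

/-- The conditions on the threshold `v`, the mean `μ` of the geometric sum of delays and the
constant `g` under which `potential v g` solves the optimality equation of the problem with cost
rate `Δ_t - (v + μ)`, for a delay `X`. The field `optimality` says that `g` is the value of sending a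
sample at age `v`; the field `normalized` is the equation for `β = v + μ`. -/
structure IsOptimalPotential (P : Measure Ω) (α : ℝ) (X : Ω → ℝ) (v μ g : ℝ) : Prop where
  mean : (1 - α) * μ = ∫ ω, X ω ∂P
  optimality : (1 - α) * (g - ((v ^ 2 + 2 * v * (∫ ω, X ω ∂P) + ∫ ω, X ω ^ 2 ∂P) / 2
    - (v + μ) * (v + ∫ ω, X ω ∂P))) = α * (∫ ω, X ω ^ 2 ∂P) / 2
  normalized : ∫ ω, (potential v g (X ω) - (X ω ^ 2 / 2 - (v + μ) * X ω)) ∂P = 0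

lemma measurable_potential (v g : ℝ) : Measurable (potential v g) := by
  unfold potential
  fun_prop

lemma sq_max_le {x B : ℝ} (hB : 0 ≤ B) (h : x ≤ B) : (max x 0) ^ 2 ≤ B ^ 2 :=
  pow_le_pow_left₀ (le_max_right _ _) (max_le h hB) 2

section Moments

variable [IsProbabilityMeasure P] {α : ℝ} {X : Ω → ℝ}

lemma integrable_potential_add (hX : MemLp X 2 P) (hX0 : ∀ ω, 0 ≤ X ω) (v g x : ℝ) :
    Integrable (fun ω => potential v g (x + X ω)) P := by
  have h1 := hX.integrable one_le_two
  have h2 := hX.integrable_sq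
  have hb : Integrable (fun ω => |g| + ((|x| + |v|) ^ 2 + 2 * (|x| + |v|) * X ω + X ω ^ 2) / 2) P :=
    (integrable_const _).add (((integrable_const _).add (h1.const_mul _)).add h2 |>.div_const 2)
  refine hb.mono' ((measurable_potential v g).comp_aemeasurable
    (hX.aemeasurable.const_add x)).aestronglyMeasurable (Eventually.of_forall fun ω => ?_)
  have h := sq_max_le (x := x + X ω - v) (B := |x| + |v| + X ω) (by have := hX0 ω; positivity)
    (by linarith [le_abs_self x, neg_abs_le v])
  rw [Real.norm_eq_abs, potential]
  refine (abs_add_le _ _).trans ?_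
  rw [abs_of_nonneg (a := _ / 2) (by positivity)]
  linarith

lemma integrable_quadratic (hX : MemLp X 2 P) (β x : ℝ) :
    Integrable (fun ω => (x + X ω) ^ 2 / 2 - β * (x + X ω)) P := by
  have h1 := hX.integrable one_le_two
  have h2 := hX.integrable_sq
  have : (fun ω => (x + X ω) ^ 2 / 2 - β * (x + X ω)) =
      fun ω => (x ^ 2 / 2 - β * x) + (x - β) * X ω + X ω ^ 2 / 2 := by
    ext ω; ring
  rw [this]
  exact ((integrable_const _).add (h1.const_mul _)).add (h2.div_const 2)

lemma integral_affine_add_sq (hX : MemLp X 2 P) (a b c : ℝ) :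
    ∫ ω, (a + b * X ω + c * X ω ^ 2) ∂P =
      a + b * (∫ ω, X ω ∂P) + c * ∫ ω, X ω ^ 2 ∂P := by
  have h1 := (hX.integrable one_le_two).const_mul b
  have h2 := hX.integrable_sq.const_mul c
  have h01 : Integrable (fun ω => a + b * X ω) P := (integrable_const a).add h1
  rw [integral_add h01 h2, integral_add (integrable_const a) h1]
  simp [integral_const_mul]

lemma integral_quadratic (hX : MemLp X 2 P) (β x : ℝ) :
    ∫ ω, ((x + X ω) ^ 2 / 2 - β * (x + X ω)) ∂P =
      (x ^ 2 + 2 * x * (∫ ω, X ω ∂P) + ∫ ω, X ω ^ 2 ∂P) / 2 - β * (x + ∫ ω, X ω ∂P) := by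
  have : (fun ω => (x + X ω) ^ 2 / 2 - β * (x + X ω)) =
      fun ω => (x ^ 2 / 2 - β * x) + (x - β) * X ω + (1 / 2) * X ω ^ 2 := by
    ext ω; ring
  rw [this, integral_affine_add_sq hX]
  ring

/-- Optimality equation, inequality: whatever the age `x ≥ a` at which the next sample is sent, the
expected potential after the transmission is at least the present one. The potential is convex, and
replaced by its tangent at the point reached by sending at age `max x v`. -/
lemma IsOptimalPotential.le_integral {v μ g : ℝ} (h : IsOptimalPotential P α X v μ g)
    (hα : 0 ≤ α) (hα₁ : α < 1) (hX : MemLp X 2 P) (hX0 : ∀ ω, 0 ≤ X ω) {a x : ℝ} (hax : a ≤ x) :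
    potential v g a ≤ (1 - α) * ∫ ω, ((x + X ω) ^ 2 / 2 - (v + μ) * (x + X ω)) ∂P
      + α * ∫ ω, potential v g (x + X ω) ∂P := by
  refine (potential_mono v g hax).trans ?_
  have hopt := h.optimality
  have hmean := h.mean
  rw [integral_quadratic hX]
  have htan : (g + (max (x - v) 0) ^ 2 / 2 + max (x - v) 0 * (x - v - max (x - v) 0))
      + (x - v) * (∫ ω, X ω ∂P) + (1 / 2) * ∫ ω, X ω ^ 2 ∂P ≤ ∫ ω, potential v g (x + X ω) ∂P := by
    rw [← integral_affine_add_sq hX]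
    refine integral_mono (((integrable_const _).add ((hX.integrable one_le_two).const_mul _)).add
      (hX.integrable_sq.const_mul _)) (integrable_potential_add hX hX0 v g x) fun ω => ?_
    have := hX0 ω
    simp only [potential]
    rcases max_cases (x - v) 0 with ⟨h₁, h₁'⟩ | ⟨h₁, h₁'⟩ <;>
    rcases max_cases (x + X ω - v) 0 with ⟨h₂, h₂'⟩ | ⟨h₂, h₂'⟩ <;> rw [h₁, h₂]
    · apply le_of_eq; ring
    · linarith
    · nlinarith [sq_nonneg (x - v)]
    · nlinarith
  have htan' := mul_le_mul_of_nonneg_left htan hα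
  set m := ∫ ω, X ω ∂P
  set m₂ := ∫ ω, X ω ^ 2 ∂P
  have h1α : 0 < 1 - α := by linarith
  refine le_trans (le_of_sub_nonneg ?_) (add_le_add_right htan' _)
  simp only [potential]
  rcases max_cases (x - v) 0 with ⟨h₁, h₁'⟩ | ⟨h₁, h₁'⟩ <;> rw [h₁]
  · apply le_of_eq
    linear_combination hopt + (x - v) * hmean
  · have h0 : 0 ≤ (1 - α) * (x - v) ^ 2 / 2 := by positivity
    have := congrArg (fun z => (x - v) * z) hmean
    beta_reduce at this
    nlinarith

/-- Optimality equation, equality at the age prescribed by the threshold rule. -/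
lemma IsOptimalPotential.eq_integral {v μ g : ℝ} (h : IsOptimalPotential P α X v μ g)
    (hX : MemLp X 2 P) (hX0 : ∀ ω, 0 ≤ X ω) (a : ℝ) :
    potential v g a =
      (1 - α) * ∫ ω, ((max a v + X ω) ^ 2 / 2 - (v + μ) * (max a v + X ω)) ∂P
      + α * ∫ ω, potential v g (max a v + X ω) ∂P := by
  have hopt := h.optimality
  have hmean := h.mean
  have hG : potential v g a = g + (max a v - v) ^ 2 / 2 := by
    rw [potential, ← max_sub_sub_right, sub_self]
  have hx : v ≤ max a v := le_max_right _ _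
  set x := max a v
  rw [hG, integral_quadratic hX]
  have : ∀ ω, potential v g (x + X ω) =
      (g + (x - v) ^ 2 / 2) + (x - v) * X ω + (1 / 2) * X ω ^ 2 := fun ω => by
    rw [potential, max_eq_left (by linarith [hX0 ω])]
    ring
  simp_rw [this]
  rw [integral_affine_add_sq hX]
  linear_combination hopt + (x - v) * hmean

end Moments

end

/-! ### Drift of the accumulated cost -/

section

variable {Ω : Type*} [MeasurableSpace Ω] {P : Measure Ω}

/-- The increment of transmission `i`, if that transmission starts before time `T`, as a function of
the feedback time, the sampling time and the generation time of the freshest sample on the one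
hand, and of the outcome of the transmission on the other hand. -/
def stoppedIncrement (v μ g T : ℝ) (p : (ℝ × ℝ × ℝ) × (ℝ × Bool)) : ℝ :=
  if p.1.2.1 < T then
    (if p.2.2 = true then
      ((p.1.2.1 - p.1.2.2 + p.2.1) ^ 2 / 2 - (v + μ) * (p.1.2.1 - p.1.2.2 + p.2.1))
        + (potential v g p.2.1 - (p.2.1 ^ 2 / 2 - (v + μ) * p.2.1))
        - potential v g (p.1.1 - p.1.2.2)
    else potential v g (p.1.2.1 - p.1.2.2 + p.2.1) - potential v g (p.1.1 - p.1.2.2))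
  else 0

lemma measurable_stoppedIncrement (v μ g T : ℝ) : Measurable (stoppedIncrement v μ g T) := by
  have hG := measurable_potential v g
  unfold stoppedIncrement
  refine Measurable.ite (measurableSet_lt (by fun_prop) measurable_const) ?_ measurable_const
  refine Measurable.ite ?_ (by fun_prop) (by fun_prop)
  exact (measurable_snd.comp measurable_snd) (measurableSet_singleton true)

lemma stoppedIncrement_eq {Ω : Type*} (S Y : ℕ → Ω → ℝ) (C : ℕ → Ω → Bool) (v μ g T : ℝ) (i : ℕ)
    (ω : Ω) :
    stoppedIncrement v μ g T ((feedback S Y i ω, S i ω, lastFresh S C i ω), (Y i ω, C i ω)) =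
      if S i ω < T then increment S Y C (v + μ) (potential v g) i ω else 0 := by
  simp only [stoppedIncrement, increment]
  have h : feedback S Y (i + 1) ω = S i ω + Y i ω := rfl
  split_ifs with h₁ h₂
  · have hu : feedback S Y (i + 1) ω - lastFresh S C (i + 1) ω = Y i ω := by
      simp [feedback, lastFresh, h₂]
    rw [hu, h, show S i ω + Y i ω - lastFresh S C i ω = S i ω - lastFresh S C i ω + Y i ω by ring]
  · have hu : lastFresh S C (i + 1) ω = lastFresh S C i ω := by
      simp [lastFresh, h₂]
    rw [hu, h, show S i ω + Y i ω - lastFresh S C i ω = S i ω - lastFresh S C i ω + Y i ω by ring]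
    ring
  · rfl

lemma abs_stoppedIncrement_le {v μ g T F s u y : ℝ} {c : Bool} (hu : 0 ≤ u) (huF : u ≤ F)
    (hFs : F ≤ s) (hy : 0 ≤ y) :
    |stoppedIncrement v μ g T ((F, s, u), (y, c))| ≤
      2 * |g| + (|T| + |v| + y) ^ 2 + (|T| + y) ^ 2 + 2 * |v + μ| * (|T| + y) := by
  have hT := abs_nonneg T
  have hv := abs_nonneg v
  have hq : ∀ z, 0 ≤ z → z ≤ |T| + y →
      |z ^ 2 / 2 - (v + μ) * z| ≤ (|T| + y) ^ 2 / 2 + |v + μ| * (|T| + y) := fun z h0 h1 => by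
    refine (abs_sub _ _).trans (add_le_add ?_ ?_)
    · rw [abs_of_nonneg (by positivity)]
      gcongr
    · rw [abs_mul, abs_of_nonneg h0]
      gcongr
  have hG : ∀ z, z ≤ |T| + y → |potential v g z| ≤ |g| + (|T| + |v| + y) ^ 2 / 2 := fun z h1 => by
    refine (abs_add_le _ _).trans (add_le_add le_rfl ?_)
    rw [abs_of_nonneg (by positivity)]
    linarith [sq_max_le (x := z - v) (B := |T| + |v| + y) (by positivity)
      (by linarith [neg_abs_le v])]
  have hb : 0 ≤ |v + μ| * (|T| + y) := by positivity
  have hg := abs_nonneg g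
  simp only [stoppedIncrement]
  split_ifs with h₁ h₂
  · have hTs : s ≤ |T| := h₁.le.trans (le_abs_self T)
    have e1 := hq (s - u + y) (by linarith) (by linarith)
    have e2 := hq y hy (by linarith)
    have e3 := hG y (by linarith)
    have e4 := hG (F - u) (by linarith)
    rw [abs_le] at *
    constructor <;> linarith
  · have hTs : s ≤ |T| := h₁.le.trans (le_abs_self T)
    have e3 := hG (s - u + y) (by linarith)
    have e4 := hG (F - u) (by linarith)
    have := sq_nonneg (|T| + y)
    rw [abs_le] at *
    constructor <;> linarith
  · rw [abs_zero]
    positivity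

lemma IsUnreliableChannel.exists_isFeasibleAt {α : ℝ}
    {Y S : ℕ → Ω → ℝ} {C : ℕ → Ω → Bool} (h : IsUnreliableChannel P α Y C)
    (hS : ∀ i ω, feedback S Y i ω ≤ S i ω) : ∃ ε, 0 < ε ∧ ∀ ω, IsFeasibleAt S Y ε ω := by
  obtain ⟨ε, hε, hY⟩ := h.delay_ge
  exact ⟨ε, hε, fun ω => ⟨hε, fun i => hS i ω, fun i => hY i ω⟩⟩

lemma IsUnreliableChannel.delay_nonneg {α : ℝ} {Y : ℕ → Ω → ℝ} {C : ℕ → Ω → Bool}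
    (h : IsUnreliableChannel P α Y C) (i : ℕ) (ω : Ω) :
    0 ≤ Y i ω := by
  obtain ⟨ε, hε, hY⟩ := h.delay_ge
  exact hε.le.trans (hY i ω)

lemma IsUnreliableChannel.measurable_state_triple {α : ℝ} {Y S : ℕ → Ω → ℝ} {C : ℕ → Ω → Bool}
    (h : IsUnreliableChannel P α Y C) (hSm : ∀ i, Measurable (S i)) (i : ℕ) :
    Measurable (fun ω => (feedback S Y i ω, S i ω, lastFresh S C i ω)) := by
  refine Measurable.mono (measurable_state_history (Y := Y) i) (Measurable.comap_le ?_) le_rfl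
  have h₁ : Measurable fun ω (j : Fin (i + 1)) => S j ω := measurable_pi_lambda _ fun j => hSm j
  have h₂ : Measurable fun ω (j : Fin i) => (Y j ω, C j ω) :=
    measurable_pi_lambda _ fun j => (h.measurable_delay j).prodMk (h.measurable_state j)
  exact h₁.prodMk h₂

section Drift

variable [IsProbabilityMeasure P] {α : ℝ} {Y S : ℕ → Ω → ℝ} {C : ℕ → Ω → Bool}

lemma IsUnreliableChannel.integrable_stoppedIncrement (h : IsUnreliableChannel P α Y C)
    (hSm : ∀ i, Measurable (S i)) (hS : ∀ i ω, feedback S Y i ω ≤ S i ω) (v μ g T : ℝ) (i : ℕ) :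
    Integrable (fun ω => if S i ω < T then increment S Y C (v + μ) (potential v g) i ω else 0) P := by
  obtain ⟨ε, -, hf⟩ := h.exists_isFeasibleAt hS
  have hst := h.measurable_state_triple hSm i
  have h1 := (h.memLp_delay i).integrable one_le_two
  have h2 := (h.memLp_delay i).integrable_sq
  have hb : Integrable (fun ω => 2 * |g| + (|T| + |v| + Y i ω) ^ 2 + (|T| + Y i ω) ^ 2
      + 2 * |v + μ| * (|T| + Y i ω)) P := by
    have : (fun ω => 2 * |g| + (|T| + |v| + Y i ω) ^ 2 + (|T| + Y i ω) ^ 2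
        + 2 * |v + μ| * (|T| + Y i ω)) = fun ω => (2 * |g| + (|T| + |v|) ^ 2 + |T| ^ 2
        + 2 * |v + μ| * |T|) + (2 * (|T| + |v|) + 2 * |T| + 2 * |v + μ|) * Y i ω
        + 2 * Y i ω ^ 2 := by
      ext ω; ring
    rw [this]
    exact ((integrable_const _).add (h1.const_mul _)).add (h2.const_mul _)
  simp_rw [← stoppedIncrement_eq]
  refine hb.mono' ((measurable_stoppedIncrement v μ g T).comp
    (hst.prodMk ((h.measurable_delay i).prodMk (h.measurable_state i)))).aestronglyMeasurable
    (Eventually.of_forall fun ω => ?_)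
  exact abs_stoppedIncrement_le ((hf ω).lastFresh_nonneg i) ((hf ω).lastFresh_le_feedback i)
    (hS i ω) (h.delay_nonneg i ω)

/-- Conditional expectation of an increment given the history: the transmission is independent of
the history, so its outcome can be integrated out first. -/
lemma IsUnreliableChannel.integral_stoppedIncrement (h : IsUnreliableChannel P α Y C)
    (hα : 0 ≤ α) (hSm : ∀ i, Measurable (S i)) (hS : ∀ i ω, feedback S Y i ω ≤ S i ω)
    (hcausal : ∀ i, IndepFun (history S Y C i) (fun ω (k : ℕ) => (Y (i + k) ω, C (i + k) ω)) P)
    {v μ g : ℝ} (hpot : IsOptimalPotential P α (Y 0) v μ g) (T : ℝ) (i : ℕ) :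
    ∫ ω, (if S i ω < T then increment S Y C (v + μ) (potential v g) i ω else 0) ∂P =
      ∫ ω, (if S i ω < T then
        ((1 - α) * ∫ ω', ((S i ω - lastFresh S C i ω + Y 0 ω') ^ 2 / 2
            - (v + μ) * (S i ω - lastFresh S C i ω + Y 0 ω')) ∂P
          + α * ∫ ω', potential v g (S i ω - lastFresh S C i ω + Y 0 ω') ∂P)
          - potential v g (feedback S Y i ω - lastFresh S C i ω) else 0) ∂P := by
  have hst := h.measurable_state_triple hSm i
  have hint := h.integrable_stoppedIncrement (C := C) hSm hS v μ g T i
  simp_rw [← stoppedIncrement_eq] at hint ⊢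
  rw [integral_comp_of_indepFun hst ((h.measurable_delay i).prodMk (h.measurable_state i))
    (indepFun_state_transmission hcausal i) (measurable_stoppedIncrement v μ g T) hint]
  refine integral_congr_ae (Eventually.of_forall fun ω => ?_)
  simp only [stoppedIncrement]
  split_ifs
  · set x := S i ω - lastFresh S C i ω
    set a := feedback S Y i ω - lastFresh S C i ω
    have hG := measurable_potential v g
    have hX := h.memLp_delay 0
    have hX0 := h.delay_nonneg 0
    have i1 := integrable_quadratic hX (v + μ) x
    have i2 : Integrable (fun ω => potential v g (Y 0 ω)
        - ((Y 0 ω) ^ 2 / 2 - (v + μ) * (Y 0 ω))) P := by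
      have := (integrable_potential_add hX hX0 v g 0).sub (integrable_quadratic hX (v + μ) 0)
      simp only [zero_add] at this
      exact this
    have i3 := integrable_potential_add hX hX0 v g x
    have i12 : Integrable (fun ω => ((x + Y 0 ω) ^ 2 / 2 - (v + μ) * (x + Y 0 ω))
        + (potential v g (Y 0 ω) - ((Y 0 ω) ^ 2 / 2 - (v + μ) * (Y 0 ω)))) P := i1.add i2
    rw [h.integral_ite hα (f₁ := fun y => (x + y) ^ 2 / 2 - (v + μ) * (x + y)
        + (potential v g y - (y ^ 2 / 2 - (v + μ) * y)) - potential v g a)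
      (f₂ := fun y => potential v g (x + y) - potential v g a) (by fun_prop) (by fun_prop)
      (i12.sub (integrable_const _)) (i3.sub (integrable_const _)),
      integral_sub i12 (integrable_const _), integral_sub i3 (integrable_const _),
      integral_add i1 i2, hpot.normalized]
    simp
    ring
  · simp

lemma IsUnreliableChannel.integral_stoppedIncrement_nonneg (h : IsUnreliableChannel P α Y C)
    (hα : 0 ≤ α) (hα₁ : α < 1) (hSm : ∀ i, Measurable (S i))
    (hS : ∀ i ω, feedback S Y i ω ≤ S i ω)
    (hcausal : ∀ i, IndepFun (history S Y C i) (fun ω (k : ℕ) => (Y (i + k) ω, C (i + k) ω)) P)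
    {v μ g : ℝ} (hpot : IsOptimalPotential P α (Y 0) v μ g) (T : ℝ) (i : ℕ) :
    0 ≤ ∫ ω, (if S i ω < T then increment S Y C (v + μ) (potential v g) i ω else 0) ∂P := by
  rw [h.integral_stoppedIncrement hα hSm hS hcausal hpot]
  refine integral_nonneg fun ω => ?_
  simp only [Pi.zero_apply]
  split_ifs
  · exact sub_nonneg.2 (hpot.le_integral hα hα₁ (h.memLp_delay 0) (h.delay_nonneg 0)
      (sub_le_sub_right (hS i ω) _))
  · exact le_rfl

lemma IsUnreliableChannel.integral_stoppedIncrement_eq_zero (h : IsUnreliableChannel P α Y C)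
    (hα : 0 ≤ α) (hSm : ∀ i, Measurable (S i)) (hS : ∀ i ω, feedback S Y i ω ≤ S i ω)
    (hcausal : ∀ i, IndepFun (history S Y C i) (fun ω (k : ℕ) => (Y (i + k) ω, C (i + k) ω)) P)
    {v μ g : ℝ} (hpot : IsOptimalPotential P α (Y 0) v μ g)
    (hthr : ∀ i ω, S i ω = max (feedback S Y i ω) (v + lastFresh S C i ω)) (T : ℝ) (i : ℕ) :
    ∫ ω, (if S i ω < T then increment S Y C (v + μ) (potential v g) i ω else 0) ∂P = 0 := by
  rw [h.integral_stoppedIncrement hα hSm hS hcausal hpot]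
  refine integral_eq_zero_of_ae (Eventually.of_forall fun ω => ?_)
  simp only [Pi.zero_apply]
  split_ifs
  · have : S i ω - lastFresh S C i ω = max (feedback S Y i ω - lastFresh S C i ω) v := by
      rw [hthr, ← max_sub_sub_right, add_sub_cancel_right]
    rw [this, ← hpot.eq_integral (h.memLp_delay 0) (h.delay_nonneg 0), sub_self]
  · rfl

end Drift

end

/-! ### Bounds on the average age -/

section

lemma le_limsup_div {E : ℝ → ℝ} {β : ℝ}
    (h : ∀ η > 0, ∃ c, ∀ T, 0 ≤ T → (β - η) * T - c ≤ E T) :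
    ENNReal.ofReal β ≤
      limsup (fun T : ℝ => ENNReal.ofReal (E T) / ENNReal.ofReal T) atTop := by
  refine ENNReal.le_of_forall_pos_le_add fun η hη _ => ?_
  have hη' : (0 : ℝ) < η := hη
  obtain ⟨c, hc⟩ := h (η / 2) (by positivity)
  have hev : ∀ᶠ T : ℝ in atTop,
      ENNReal.ofReal (β - η) ≤ ENNReal.ofReal (E T) / ENNReal.ofReal T := by
    filter_upwards [eventually_gt_atTop 0, eventually_ge_atTop (c / (η / 2))] with T hT hT'
    rw [← ENNReal.ofReal_div_of_pos hT]
    refine ENNReal.ofReal_le_ofReal ((le_div_iff₀ hT).2 ?_)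
    have := hc T hT.le
    have := (div_le_iff₀ (by positivity)).1 hT'
    linarith
  calc ENNReal.ofReal β = ENNReal.ofReal ((β - η) + η) := by ring_nf
    _ ≤ ENNReal.ofReal (β - η) + ENNReal.ofReal η := ENNReal.ofReal_add_le
    _ ≤ _ := by
      rw [ENNReal.ofReal_coe_nnreal]
      gcongr
      exact le_limsup_of_frequently_le hev.frequently

lemma limsup_div_le {E : ℝ → ℝ} {β : ℝ}
    (h : ∀ η > 0, ∃ c, ∀ T, 0 ≤ T → E T ≤ (β + η) * T + c) :
    limsup (fun T : ℝ => ENNReal.ofReal (E T) / ENNReal.ofReal T) atTop ≤ ENNReal.ofReal β := by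
  refine ENNReal.le_of_forall_pos_le_add fun η hη _ => ?_
  have hη' : (0 : ℝ) < η := hη
  obtain ⟨c, hc⟩ := h (η / 2) (by positivity)
  have hev : ∀ᶠ T : ℝ in atTop,
      ENNReal.ofReal (E T) / ENNReal.ofReal T ≤ ENNReal.ofReal (β + η) := by
    filter_upwards [eventually_gt_atTop 0, eventually_ge_atTop (c / (η / 2))] with T hT hT'
    rw [← ENNReal.ofReal_div_of_pos hT]
    refine ENNReal.ofReal_le_ofReal ((div_le_iff₀ hT).2 ?_)
    have := hc T hT.le
    have := (div_le_iff₀ (by positivity)).1 hT'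
    linarith
  refine (limsup_le_of_le (by isBoundedDefault) hev).trans (ENNReal.ofReal_add_le.trans ?_)
  rw [ENNReal.ofReal_coe_nnreal]

lemma exists_nat_lt_mul_le {ε T : ℝ} (hε : 0 < ε) (hT : 0 ≤ T) :
    ∃ K : ℕ, T < K * ε ∧ (K : ℝ) ≤ T / ε + 1 := by
  refine ⟨⌊T / ε⌋₊ + 1, ?_, ?_⟩ <;> push_cast
  · exact (div_lt_iff₀ hε).1 (Nat.lt_floor_add_one (T / ε))
  · linarith [Nat.floor_le (div_nonneg hT hε.le)]

section Measurability

/-- The supremum over all transmissions, where those not yet delivered count as `0`. Both sides are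
suprema of the same set, so boundedness is not needed. -/
lemma freshest_eq_iSup {Ω : Type*} (S Y : ℕ → Ω → ℝ) (C : ℕ → Ω → Bool) (t : ℝ) (ω : Ω) :
    freshest S Y C t ω = ⨆ i : Option ℕ, Option.elim i 0
      (fun i => if C i ω = true ∧ S i ω + Y i ω ≤ t then S i ω else 0) := by
  rw [freshest, iSup]
  congr 1
  ext s
  simp only [Set.mem_ofPred_eq, Set.mem_range]
  constructor
  · rintro (rfl | ⟨i, hC, hi, rfl⟩)
    · exact ⟨none, rfl⟩
    · exact ⟨some i, by simp [hC, hi]⟩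
  · rintro ⟨_ | i, rfl⟩
    · exact Or.inl rfl
    · by_cases h : C i ω = true ∧ S i ω + Y i ω ≤ t
      · exact Or.inr ⟨i, h.1, h.2, by simp [h.1, h.2]⟩
      · exact Or.inl (by simp only [Option.elim_some, if_neg h])

lemma measurable_freshest {Ω : Type*} [MeasurableSpace Ω] {S Y : ℕ → Ω → ℝ} {C : ℕ → Ω → Bool}
    (hS : ∀ i, Measurable (S i)) (hY : ∀ i, Measurable (Y i)) (hC : ∀ i, Measurable (C i)) :
    Measurable (fun p : ℝ × Ω => freshest S Y C p.1 p.2) := by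
  simp_rw [freshest_eq_iSup]
  refine Measurable.iSup fun i => ?_
  cases i with
  | none => exact measurable_const
  | some i =>
    have h1 := (hS i).comp (measurable_snd : Measurable (Prod.snd : ℝ × Ω → Ω))
    have h2 := (hY i).comp (measurable_snd : Measurable (Prod.snd : ℝ × Ω → Ω))
    have h3 := (hC i).comp (measurable_snd : Measurable (Prod.snd : ℝ × Ω → Ω))
    exact Measurable.ite ((h3 (measurableSet_singleton true)).inter
      (measurableSet_le (h1.add h2) measurable_fst)) h1 measurable_const

end Measurability

/-- The second moment of the delay beyond a high level is small. -/
lemma IsUnreliableChannel.exists_truncation {Ω : Type*} [MeasurableSpace Ω]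
    {P : Measure Ω} {α : ℝ} {Y : ℕ → Ω → ℝ} {C : ℕ → Ω → Bool} (h : IsUnreliableChannel P α Y C) {η : ℝ} (hη : 0 < η) :
    ∃ L : ℝ, ∫ ω, max (Y 0 ω ^ 2 - L) 0 ∂P < η := by
  have h2 := (h.memLp_delay 0).integrable_sq
  have hlim : Tendsto (fun n : ℕ => ∫ ω, max (Y 0 ω ^ 2 - n) 0 ∂P) atTop (nhds (∫ _, 0 ∂P)) := by
    refine tendsto_integral_of_dominated_convergence (fun ω => Y 0 ω ^ 2) (fun n => ?_) h2
      (fun n => Eventually.of_forall fun ω => ?_) (Eventually.of_forall fun ω => ?_)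
    · have := h.measurable_delay 0
      exact Measurable.aestronglyMeasurable (by fun_prop)
    · rw [Real.norm_eq_abs, abs_of_nonneg (le_max_right _ _)]
      exact max_le (by linarith [(n.cast_nonneg : (0 : ℝ) ≤ n)]) (sq_nonneg _)
    · refine tendsto_const_nhds.congr' ?_
      obtain ⟨N, hN⟩ := exists_nat_gt (Y 0 ω ^ 2)
      filter_upwards [eventually_ge_atTop N] with n hn
      have : (N : ℝ) ≤ n := by exact_mod_cast hn
      rw [max_eq_right (by linarith)]
  rw [integral_zero] at hlim
  obtain ⟨n, hn⟩ := (hlim.eventually (gt_mem_nhds hη)).exists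
  exact ⟨n, hn⟩

variable {Ω : Type*} [MeasurableSpace Ω] {P : Measure Ω} [IsProbabilityMeasure P] {α : ℝ}
  {Y S : ℕ → Ω → ℝ} {C : ℕ → Ω → Bool}

lemma IsUnreliableChannel.integrable_integral_age (h : IsUnreliableChannel P α Y C)
    (hSm : ∀ i, Measurable (S i)) (hS : ∀ i ω, feedback S Y i ω ≤ S i ω) {T : ℝ} (hT : 0 ≤ T) :
    Integrable (fun ω => ∫ t in (0 : ℝ)..T, age S Y C t ω) P := by
  obtain ⟨ε, -, hf⟩ := h.exists_isFeasibleAt hS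
  have hm : Measurable (fun p : Ω × ℝ => age S Y C p.2 p.1) :=
    measurable_snd.sub
      ((measurable_freshest hSm h.measurable_delay h.measurable_state).comp measurable_swap)
  simp_rw [intervalIntegral.integral_of_le hT]
  refine (integrable_const (T * T)).mono'
    hm.stronglyMeasurable.integral_prod_right'.aestronglyMeasurable
    (Eventually.of_forall fun ω => ?_)
  refine (norm_setIntegral_le_of_norm_le_const (C := T) (by simp) fun t ht => ?_).trans ?_
  · rw [Real.norm_eq_abs, abs_of_nonneg ((hf ω).age_nonneg ht.1.le)]
    exact ((hf ω).age_le ht.1.le).trans ht.2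
  · simp [measureReal_def, hT]

lemma IsUnreliableChannel.lintegral_age (h : IsUnreliableChannel P α Y C)
    (hSm : ∀ i, Measurable (S i)) (hS : ∀ i ω, feedback S Y i ω ≤ S i ω) {T : ℝ} (hT : 0 ≤ T) :
    ∫⁻ ω, (∫⁻ t in Set.Ioc (0 : ℝ) T, ENNReal.ofReal (age S Y C t ω)) ∂P =
      ENNReal.ofReal (∫ ω, (∫ t in (0 : ℝ)..T, age S Y C t ω) ∂P) := by
  obtain ⟨ε, -, hf⟩ := h.exists_isFeasibleAt hS
  rw [ofReal_integral_eq_lintegral_ofReal (h.integrable_integral_age hSm hS hT)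
    (Eventually.of_forall fun ω =>
      intervalIntegral.integral_nonneg hT fun t ht => (hf ω).age_nonneg ht.1)]
  refine lintegral_congr fun ω => ?_
  obtain ⟨n, h₁, h₂⟩ := (hf ω).exists_feedback_le_lt hT
  have hint := ((hf ω).integral_age (C := C) 0 0 n h₁ h₂.le).1
  rw [intervalIntegral.integral_of_le hT, ofReal_integral_eq_lintegral_ofReal
    ((intervalIntegrable_iff_integrableOn_Ioc_of_le hT).1 hint)]
  exact (ae_restrict_iff' measurableSet_Ioc).2
    (Eventually.of_forall fun t ht => (hf ω).age_nonneg ht.1.le)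

lemma IsUnreliableChannel.avgAge_eq (h : IsUnreliableChannel P α Y C)
    (hSm : ∀ i, Measurable (S i)) (hS : ∀ i ω, feedback S Y i ω ≤ S i ω) :
    avgAge P Y C S = limsup (fun T : ℝ =>
      ENNReal.ofReal (∫ ω, (∫ t in (0 : ℝ)..T, age S Y C t ω) ∂P) / ENNReal.ofReal T) atTop := by
  refine limsup_congr ?_
  filter_upwards [eventually_ge_atTop 0] with T hT
  rw [h.lintegral_age hSm hS hT]

lemma IsUnreliableChannel.integral_sum_truncation (h : IsUnreliableChannel P α Y C) (L : ℝ)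
    (K : ℕ) : Integrable (fun ω => L + ∑ i ∈ Finset.range K, max (Y i ω ^ 2 - L) 0) P ∧
      ∫ ω, (L + ∑ i ∈ Finset.range K, max (Y i ω ^ 2 - L) 0) ∂P =
        L + K * ∫ ω, max (Y 0 ω ^ 2 - L) 0 ∂P := by
  have hi : ∀ i, Integrable (fun ω => max (Y i ω ^ 2 - L) 0) P := fun i =>
    ((h.memLp_delay i).integrable_sq.sub (integrable_const L)).sup (integrable_zero _ _ _)
  have hs := integrable_finsetSum (Finset.range K) fun i _ => hi i
  refine ⟨(integrable_const L).add hs, ?_⟩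
  rw [integral_add (integrable_const L) hs, integral_finsetSum _ fun i _ => hi i]
  have : ∀ i, ∫ ω, max (Y i ω ^ 2 - L) 0 ∂P = ∫ ω, max (Y 0 ω ^ 2 - L) 0 ∂P := fun i =>
    h.integral_comp_delay (f := fun y => max (y ^ 2 - L) 0) (by fun_prop) i
  simp [this]

/-- No causal feasible policy has an average age below `v + μ`. -/
lemma IsUnreliableChannel.le_avgAge (h : IsUnreliableChannel P α Y C) (hα : 0 ≤ α) (hα₁ : α < 1)
    (hSm : ∀ i, Measurable (S i)) (hS : ∀ i ω, feedback S Y i ω ≤ S i ω)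
    (hcausal : ∀ i, IndepFun (history S Y C i) (fun ω (k : ℕ) => (Y (i + k) ω, C (i + k) ω)) P)
    {v μ g : ℝ} (hpot : IsOptimalPotential P α (Y 0) v μ g) (hμ : 0 ≤ μ) (hβ : 0 < v + μ) :
    ENNReal.ofReal (v + μ) ≤ avgAge P Y C S := by
  obtain ⟨ε, hε, hf⟩ := h.exists_isFeasibleAt hS
  rw [h.avgAge_eq hSm hS]
  refine le_limsup_div fun η hη => ?_
  -- `δ` is such that `4 * δ * β = η / 2`
  set δ := η / (8 * (v + μ)) with hδ
  have hδ0 : 0 < δ := by positivity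
  set b := 1 / (4 * δ) + 2 with hb
  have hb0 : 0 < b := by positivity
  set a := g + v ^ 2 / 2 - potential v g 0 + μ ^ 2 / (4 * δ) + μ ^ 2
  obtain ⟨L, hL⟩ := h.exists_truncation (η := η / 2 * ε / b) (by positivity)
  set e := ∫ ω, max (Y 0 ω ^ 2 - L) 0 ∂P with he
  have he0 : 0 ≤ e := integral_nonneg fun ω => le_max_right _ _
  refine ⟨max (a + b * (L + e)) 0, fun T hT => ?_⟩
  obtain ⟨K, hK, hK'⟩ := exists_nat_lt_mul_le hε hT
  have hIM := integrable_finsetSum (Finset.range K) fun i _ =>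
    h.integrable_stoppedIncrement (C := C) hSm hS v μ g T i
  have hM : 0 ≤ ∫ ω, ∑ i ∈ Finset.range K,
      (if S i ω < T then increment S Y C (v + μ) (potential v g) i ω else 0) ∂P := by
    rw [integral_finsetSum _ fun i _ => h.integrable_stoppedIncrement (C := C) hSm hS v μ g T i]
    exact Finset.sum_nonneg fun i _ =>
      h.integral_stoppedIncrement_nonneg hα hα₁ hSm hS hcausal hpot T i
  obtain ⟨hIR, hR⟩ := h.integral_sum_truncation L K
  have hIJ := h.integrable_integral_age (C := C) hSm hS hT
  have i1 : Integrable (fun ω => (v + μ) * T + ∑ i ∈ Finset.range K,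
      (if S i ω < T then increment S Y C (v + μ) (potential v g) i ω else 0)) P :=
    (integrable_const _).add hIM
  have i2 := i1.sub (integrable_const a)
  have i3 := hIR.const_mul b
  have hle := integral_mono (i2.sub i3) (hIJ.const_mul (1 + 4 * δ))
    fun ω => (hf ω).le_integral_age g hμ hβ.le hδ0 L hT hK
  rw [integral_sub' i2 i3, integral_sub' i1 (integrable_const a),
    integral_add (integrable_const _) hIM, integral_const_mul b, integral_const_mul (1 + 4 * δ), hR] at hle
  simp only [integral_const, probReal_univ, one_smul] at hle
  set J := ∫ ω, (∫ t in (0 : ℝ)..T, age S Y C t ω) ∂P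
  have hmax := le_max_left (a + b * (L + e)) 0
  have hmax' := le_max_right (a + b * (L + e)) 0
  rcases le_total ((v + μ) * T) J with hJ | hJ
  · have := mul_nonneg hη.le hT
    linarith
  · have h4 : 4 * δ * J ≤ η / 2 * T := by
      calc 4 * δ * J ≤ 4 * δ * ((v + μ) * T) := by gcongr
        _ = η / 2 * T := by rw [hδ]; field_simp; ring
    have hbe : b * e * (T / ε) ≤ η / 2 * T := by
      have : b * e ≤ η / 2 * ε := by
        rw [lt_div_iff₀ hb0] at hL
        linarith
      calc b * e * (T / ε) ≤ η / 2 * ε * (T / ε) := by gcongr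
        _ = η / 2 * T := by field_simp
    have hbK : b * (K * e) ≤ b * e * (T / ε) + b * e := by
      calc b * (K * e) = b * e * K := by ring
        _ ≤ b * e * (T / ε + 1) := by gcongr
        _ = _ := by ring
    linarith

/-- The threshold rule attains the average age `v + μ`. -/
lemma IsUnreliableChannel.avgAge_le (h : IsUnreliableChannel P α Y C) (hα : 0 ≤ α)
    (hSm : ∀ i, Measurable (S i)) (hS : ∀ i ω, feedback S Y i ω ≤ S i ω)
    (hcausal : ∀ i, IndepFun (history S Y C i) (fun ω (k : ℕ) => (Y (i + k) ω, C (i + k) ω)) P)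
    {v μ g : ℝ} (hpot : IsOptimalPotential P α (Y 0) v μ g) (hμ : 0 ≤ μ) (hβ : 0 < v + μ)
    (hthr : ∀ i ω, S i ω = max (feedback S Y i ω) (v + lastFresh S C i ω)) :
    avgAge P Y C S ≤ ENNReal.ofReal (v + μ) := by
  obtain ⟨ε, hε, hf⟩ := h.exists_isFeasibleAt hS
  rw [h.avgAge_eq hSm hS]
  refine limsup_div_le fun η hη => ?_
  obtain ⟨L, hL⟩ := h.exists_truncation (η := η * ε / (v + μ)) (by positivity)
  set e := ∫ ω, max (Y 0 ω ^ 2 - L) 0 ∂P with he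
  have he0 : 0 ≤ e := integral_nonneg fun ω => le_max_right _ _
  refine ⟨(potential v g 0 - g + (v + μ)) + (v + μ) * (L + e), fun T hT => ?_⟩
  obtain ⟨K, hK, hK'⟩ := exists_nat_lt_mul_le hε hT
  have hIM := integrable_finsetSum (Finset.range K) fun i _ =>
    h.integrable_stoppedIncrement (C := C) hSm hS v μ g T i
  have hM : ∫ ω, ∑ i ∈ Finset.range K,
      (if S i ω < T then increment S Y C (v + μ) (potential v g) i ω else 0) ∂P = 0 := by
    rw [integral_finsetSum _ fun i _ => h.integrable_stoppedIncrement (C := C) hSm hS v μ g T i]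
    exact Finset.sum_eq_zero fun i _ =>
      h.integral_stoppedIncrement_eq_zero hα hSm hS hcausal hpot hthr T i
  obtain ⟨hIR, hR⟩ := h.integral_sum_truncation L K
  have hIJ := h.integrable_integral_age (C := C) hSm hS hT
  have i1 : Integrable (fun ω => (v + μ) * T + ∑ i ∈ Finset.range K,
      (if S i ω < T then increment S Y C (v + μ) (potential v g) i ω else 0)) P :=
    (integrable_const _).add hIM
  have i2 := i1.add (integrable_const (potential v g 0 - g + (v + μ)))
  have i3 := hIR.const_mul (v + μ)
  have hle := integral_mono hIJ (i2.add i3)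
    fun ω => (hf ω).integral_age_le g hμ hβ.le (fun i => hthr i ω) L hT hK
  rw [integral_add' i2 i3, integral_add' i1 (integrable_const _),
    integral_add (integrable_const _) hIM, hM] at hle
  simp only [integral_const, probReal_univ, one_smul] at hle
  rw [integral_const_mul, hR] at hle
  have hbe : (v + μ) * e * (T / ε) ≤ η * T := by
    have : (v + μ) * e ≤ η * ε := by
      rw [lt_div_iff₀ hβ] at hL
      linarith
    calc (v + μ) * e * (T / ε) ≤ η * ε * (T / ε) := by gcongr
      _ = η * T := by field_simp
  have hbK : (v + μ) * (K * e) ≤ (v + μ) * e * (T / ε) + (v + μ) * e := by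
    calc (v + μ) * (K * e) = (v + μ) * e * K := by ring
      _ ≤ (v + μ) * e * (T / ε + 1) := by gcongr
      _ = _ := by ring
  linarith

end

/-! ### The mean square error -/

section

lemma lintegral_sq_gaussianReal (v : ℝ≥0) :
    ∫⁻ x, ENNReal.ofReal (x ^ 2) ∂(gaussianReal 0 v) = v := by
  have h2 := (memLp_id_gaussianReal (μ := 0) (v := v) 2).integrable_sq
  simp only [id_eq] at h2
  rw [← ofReal_integral_eq_lintegral_ofReal h2 (Eventually.of_forall fun x => sq_nonneg x)]
  have := variance_of_integral_eq_zero (X := fun x : ℝ => x) (μ := gaussianReal 0 v)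
    measurable_id.aemeasurable integral_id_gaussianReal
  rw [← this, variance_fun_id_gaussianReal, ENNReal.ofReal_coe_nnreal]

/-- Real functions on `ℝ≥0` which are continuous, with the σ-algebra generated by the coordinates. -/
abbrev ContPath : Type := {w : ℝ≥0 → ℝ // Continuous w}

lemma measurable_contPath_eval : Measurable (fun p : ℝ≥0 × ContPath => p.2.1 p.1) := by
  refine measurable_uncurry_of_continuous_of_measurable (u := fun (t : ℝ≥0) (w : ContPath) => w.1 t)
    (fun w => w.2) fun t => ?_
  exact (measurable_pi_apply t).comp measurable_subtype_coe

variable {Ω : Type*} [MeasurableSpace Ω] {P : Measure Ω} {W : ℝ≥0 → Ω → ℝ}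

/-- A Brownian motion agrees almost surely with a random continuous path. -/
lemma exists_contPath (hWmeas : ∀ t, Measurable (W t)) (hW : IsBrownianReal W P) :
    ∃ X : Ω → ContPath, Measurable X ∧ ∀ᵐ ω ∂P, ∀ t, W t ω = (X ω).1 t := by
  classical
  obtain ⟨N, hN, hNm, hN0⟩ := exists_measurable_superset_of_null (ae_iff.1 hW.cont)
  have hc : ∀ ω, Continuous (fun t => if ω ∈ N then 0 else W t ω) := fun ω => by
    by_cases h : ω ∈ N
    · simpa only [if_pos h] using continuous_const
    · simp only [if_neg h]
      by_contra hcon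
      exact h (hN hcon)
  refine ⟨fun ω => ⟨fun t => if ω ∈ N then 0 else W t ω, hc ω⟩, ?_, ?_⟩
  · exact (measurable_pi_lambda _ fun t =>
      Measurable.ite hNm measurable_const (hWmeas t)).subtype_mk
  · filter_upwards [measure_eq_zero_iff_ae_notMem.1 hN0] with ω hω t
    simp [hω]

lemma lintegral_sq_increment (hW : IsBrownianReal W P) {s t : ℝ} (hs : 0 ≤ s) (hst : s ≤ t) :
    ∫⁻ ω, ENNReal.ofReal ((W t.toNNReal ω - W s.toNNReal ω) ^ 2) ∂P = ENNReal.ofReal (t - s) := by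
  have hlaw := hW.toIsPreBrownianReal.hasLaw_sub t.toNNReal s.toNNReal
  have := hlaw.lintegral_comp (f := fun x => ENNReal.ofReal (x ^ 2)) (by fun_prop)
  simp only [Pi.sub_apply] at this
  rw [this, lintegral_sq_gaussianReal, ← ENNReal.ofReal_coe_nnreal]
  congr 1
  have ht := hs.trans hst
  rw [coe_nndist, Real.dist_eq]
  change |((t.toNNReal : ℝ) - (s.toNNReal : ℝ))| = t - s
  rw [Real.coe_toNNReal _ hs, Real.coe_toNNReal _ ht, abs_of_nonneg (by linarith)]

/-- The error incurred by estimating a Brownian motion by its value at an earlier time which is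
independent of it has the elapsed time as its mean square. -/
lemma lintegral_sq_error [IsProbabilityMeasure P] {Z : Type*} [MeasurableSpace Z]
    (hWmeas : ∀ t, Measurable (W t)) (hW : IsBrownianReal W P) {ξ : Ω → Z} (hξ : Measurable ξ)
    (hind : IndepFun (fun ω t => W t ω) ξ P) {u : ℝ × Z → ℝ} (hu : Measurable u) {T : ℝ}
    (hu0 : ∀ t, 0 ≤ t → ∀ ω, 0 ≤ u (t, ξ ω) ∧ u (t, ξ ω) ≤ t) :
    ∫⁻ ω, (∫⁻ t in Set.Ioc (0 : ℝ) T,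
        ENNReal.ofReal ((W t.toNNReal ω - W (u (t, ξ ω)).toNNReal ω) ^ 2)) ∂P =
      ∫⁻ ω, (∫⁻ t in Set.Ioc (0 : ℝ) T, ENNReal.ofReal (t - u (t, ξ ω))) ∂P := by
  obtain ⟨X, hX, hWX⟩ := exists_contPath hWmeas hW
  have hind' : IndepFun X ξ P := by
    have h : IndepFun (fun ω => (X ω).1) ξ P := by
      refine hind.congr ?_ EventuallyEq.rfl
      filter_upwards [hWX] with ω hω using funext hω
    rw [IndepFun_iff_Indep] at h ⊢
    change Indep (MeasurableSpace.comap X (MeasurableSpace.comap Subtype.val _)) _ P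
    rw [MeasurableSpace.comap_comp]
    exact h
  have hmap := (indepFun_iff_map_prod_eq_prod_map_map hX.aemeasurable hξ.aemeasurable).1 hind'
  have := Measure.isProbabilityMeasure_map (μ := P) hX.aemeasurable
  have := Measure.isProbabilityMeasure_map (μ := P) hξ.aemeasurable
  -- the squared error as a function of the path, the independent variable and the time
  have hF : Measurable (fun p : (ContPath × Z) × ℝ => ENNReal.ofReal
      ((p.1.1.1 p.2.toNNReal - p.1.1.1 (u (p.2, p.1.2)).toNNReal) ^ 2)) := by
    have e1 : Measurable (fun p : (ContPath × Z) × ℝ => p.1.1.1 p.2.toNNReal) :=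
      measurable_contPath_eval.comp ((measurable_snd.real_toNNReal).prodMk
        (measurable_fst.comp measurable_fst))
    have e2 : Measurable (fun p : (ContPath × Z) × ℝ => p.1.1.1 (u (p.2, p.1.2)).toNNReal) :=
      measurable_contPath_eval.comp
        ((hu.comp (measurable_snd.prodMk (measurable_snd.comp measurable_fst))).real_toNNReal.prodMk
        (measurable_fst.comp measurable_fst))
    exact ((e1.sub e2).pow_const 2).ennreal_ofReal
  have hH := hF.lintegral_prod_right' (ν := volume.restrict (Set.Ioc (0 : ℝ) T))
  have hcongr : ∫⁻ ω, (∫⁻ t in Set.Ioc (0 : ℝ) T,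
        ENNReal.ofReal ((W t.toNNReal ω - W (u (t, ξ ω)).toNNReal ω) ^ 2)) ∂P =
      ∫⁻ ω, (∫⁻ t in Set.Ioc (0 : ℝ) T,
        ENNReal.ofReal (((X ω).1 t.toNNReal - (X ω).1 (u (t, ξ ω)).toNNReal) ^ 2)) ∂P := by
    refine lintegral_congr_ae ?_
    filter_upwards [hWX] with ω hω
    simp_rw [hω]
  rw [hcongr, ← lintegral_map (f := fun p : ContPath × Z => ∫⁻ t in Set.Ioc (0 : ℝ) T,
      ENNReal.ofReal ((p.1.1 t.toNNReal - p.1.1 (u (t, p.2)).toNNReal) ^ 2)) hH (hX.prodMk hξ),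
    hmap, lintegral_prod_symm _ hH.aemeasurable, lintegral_map hH.lintegral_prod_left' hξ]
  refine lintegral_congr fun ω => ?_
  have hH' : Measurable (fun w : ContPath => ∫⁻ t in Set.Ioc (0 : ℝ) T,
      ENNReal.ofReal ((w.1 t.toNNReal - w.1 (u (t, ξ ω)).toNNReal) ^ 2)) :=
    hH.comp (measurable_id.prodMk measurable_const)
  rw [lintegral_map hH' hX, lintegral_lintegral_swap]
  · refine setLIntegral_congr_fun measurableSet_Ioc fun t ht => ?_
    obtain ⟨h0, h1⟩ := hu0 t ht.1.le ω
    rw [← lintegral_sq_increment hW h0 h1]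
    refine lintegral_congr_ae ?_
    filter_upwards [hWX] with ω' hω'
    simp_rw [hω']
  · exact (hF.comp (((hX.comp measurable_fst).prodMk measurable_const).prodMk
      measurable_snd)).aemeasurable

/-- For policies that do not look at the signal, the mean square error is the average age. -/
lemma IsSignalAgnostic.avgMSE_eq_avgAge [IsProbabilityMeasure P] {α : ℝ} {Y S : ℕ → Ω → ℝ} {C : ℕ → Ω → Bool}
    (hS : IsSignalAgnostic P W Y C S) (h : IsUnreliableChannel P α Y C)
    (hWmeas : ∀ t, Measurable (W t)) (hW : IsBrownianReal W P) :
    avgMSE P W Y C S = avgAge P Y C S := by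
  obtain ⟨ε, -, hf⟩ := h.exists_isFeasibleAt hS.feasible
  -- the sequences of sampling times, delays and channel states, as functions on the sequence space
  let S' : ℕ → (ℕ → ℝ × ℝ × Bool) → ℝ := fun i z => (z i).1
  let Y' : ℕ → (ℕ → ℝ × ℝ × Bool) → ℝ := fun i z => (z i).2.1
  let C' : ℕ → (ℕ → ℝ × ℝ × Bool) → Bool := fun i z => (z i).2.2
  have hu : Measurable (fun p : ℝ × (ℕ → ℝ × ℝ × Bool) => freshest S' Y' C' p.1 p.2) :=
    measurable_freshest (fun i => (measurable_pi_apply i).fst)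
      (fun i => (measurable_pi_apply i).snd.fst) (fun i => (measurable_pi_apply i).snd.snd)
  have hξ : Measurable (fun ω i => (S i ω, Y i ω, C i ω)) := measurable_pi_lambda _ fun i =>
    (hS.measurable i).prodMk ((h.measurable_delay i).prodMk (h.measurable_state i))
  refine limsup_congr (Eventually.of_forall fun T => ?_)
  congr 1
  refine lintegral_sq_error hWmeas hW hξ hS.agnostic hu fun t ht ω => ?_
  exact ⟨(hf ω).freshest_nonneg ht, sub_nonneg.1 ((hf ω).age_nonneg (C := C) ht)⟩

end

/-! ### Moments of the geometric sum of delays -/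

section

section RandomSum

variable {Ω' : Type*} [MeasurableSpace Ω'] {Q : Measure Ω'}

lemma setIntegral_of_indepFun {M : Ω' → ℕ} (hM : Measurable M) {X : Ω' → ℝ}
    (hX : Integrable X Q) (h : IndepFun M X Q) [IsFiniteMeasure Q] (m : ℕ) :
    ∫ ω in {ω | M ω = m}, X ω ∂Q = Q.real {ω | M ω = m} * ∫ ω, X ω ∂Q := by
  have hs : MeasurableSet {ω | M ω = m} := hM (measurableSet_singleton m)
  have hind : IndepFun (fun ω => if M ω = m then (1 : ℝ) else 0) X Q :=
    h.comp (φ := fun k => if k = m then (1 : ℝ) else 0) (ψ := id) (measurable_of_countable _)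
      measurable_id
  have hI : (fun ω => if M ω = m then (1 : ℝ) else 0) = {ω | M ω = m}.indicator 1 := by
    ext ω
    simp [Set.indicator_apply]
  have hi : Integrable (fun ω => if M ω = m then (1 : ℝ) else 0) Q := by
    rw [hI]
    exact (integrable_const (1 : ℝ)).indicator hs
  have := hind.integral_fun_mul_eq_mul_integral hi.aestronglyMeasurable hX.aestronglyMeasurable
  rw [hI, integral_indicator_one hs] at this
  rw [← this, ← integral_indicator hs]
  refine integral_congr_ae (Eventually.of_forall fun ω => ?_)
  by_cases hω : M ω = m <;> simp [hω]

/-- Expectation of a nonnegative sequence evaluated at an independent random index. -/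
lemma integral_random_index [IsFiniteMeasure Q] {M : Ω' → ℕ} (hM : Measurable M)
    {X : ℕ → Ω' → ℝ} (hX : ∀ m, Integrable (X m) Q) (hX0 : ∀ m, 0 ≤ᵐ[Q] X m)
    (h : ∀ m, IndepFun M (X m) Q) {c : ℝ}
    (hc : HasSum (fun m => Q.real {ω | M ω = m} * ∫ ω, X m ω ∂Q) c) :
    Integrable (fun ω => X (M ω) ω) Q ∧ ∫ ω, X (M ω) ω ∂Q = c := by
  have hs : ∀ m, MeasurableSet {ω | M ω = m} := fun m => hM (measurableSet_singleton m)
  have hU : ⋃ m, {ω | M ω = m} = Set.univ := by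
    ext ω
    simp
  have hd : Pairwise (Function.onFun Disjoint fun m => {ω | M ω = m}) := fun m n hmn =>
    Set.disjoint_left.2 fun ω h₁ h₂ => hmn (h₁.symm.trans h₂)
  have hint : ∀ m, ∫ ω in {ω | M ω = m}, X (M ω) ω ∂Q =
      Q.real {ω | M ω = m} * ∫ ω, X m ω ∂Q := fun m => by
    rw [← setIntegral_of_indepFun hM (hX m) (h m)]
    exact setIntegral_congr_fun (hs m) fun ω (hω : M ω = m) => by simp only [hω]
  have hnorm : ∀ m, ∫ ω in {ω | M ω = m}, ‖X (M ω) ω‖ ∂Q =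
      Q.real {ω | M ω = m} * ∫ ω, X m ω ∂Q := fun m => by
    rw [← setIntegral_of_indepFun hM (hX m) (h m)]
    refine setIntegral_congr_ae (hs m) ?_
    filter_upwards [hX0 m] with ω hω (hm : M ω = m)
    rw [hm, Real.norm_of_nonneg hω]
  have hI : Integrable (fun ω => X (M ω) ω) Q := by
    rw [← integrableOn_univ, ← hU]
    refine integrableOn_iUnion_of_summable_integral_norm (fun m => ?_) ?_
    · exact (hX m).integrableOn.congr_fun (fun ω (hω : M ω = m) => by simp only [hω]) (hs m)
    · simp_rw [hnorm]
      exact hc.summable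
  refine ⟨hI, ?_⟩
  have := hasSum_integral_iUnion hs hd (f := fun ω => X (M ω) ω) (μ := Q) hI.integrableOn
  simp_rw [hint] at this
  rw [hU, setIntegral_univ] at this
  exact this.unique hc

lemma hasSum_geometric_mean {α : ℝ} (hα : 0 ≤ α) (hα₁ : α < 1) :
    HasSum (fun j : ℕ => α ^ j * (1 - α) * ((j : ℝ) + 1)) (1 / (1 - α)) := by
  have h := (hasSum_choose_mul_geometric_of_norm_lt_one 1
    (show ‖α‖ < 1 by rwa [Real.norm_of_nonneg hα])).mul_right (1 - α)
  have h1 : 1 - α ≠ 0 := by linarith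
  convert! h using 1
  · ext j
    simp
    ring
  · field_simp

lemma hasSum_geometric_sq {α : ℝ} (hα : 0 ≤ α) (hα₁ : α < 1) :
    HasSum (fun j : ℕ => α ^ j * (1 - α) * ((j : ℝ) + 1) ^ 2)
      (2 / (1 - α) ^ 2 - 1 / (1 - α)) := by
  have h := ((hasSum_choose_mul_geometric_of_norm_lt_one 2
    (show ‖α‖ < 1 by rwa [Real.norm_of_nonneg hα])).mul_right (2 * (1 - α))).sub
    (hasSum_geometric_mean hα hα₁)
  have h1 : 1 - α ≠ 0 := by linarith
  convert! h using 1
  · ext j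
    rw [Nat.cast_choose_two]
    push_cast
    ring
  · field_simp
    ring

end RandomSum

section Epoch

variable {Ω Ω' : Type*} [MeasurableSpace Ω] [MeasurableSpace Ω'] {P : Measure Ω} {Q : Measure Ω'}
  {X : Ω → ℝ} {α : ℝ} {V : ℕ → Ω' → ℝ} {M : Ω' → ℕ}

lemma IsEpochSample.memLp (h : IsEpochSample P X α Q V M) (hX : MemLp X 2 P) (k : ℕ) :
    MemLp (V k) 2 Q := (h.identDistrib k).symm.memLp_snd hX

lemma IsEpochSample.integral_comp (h : IsEpochSample P X α Q V M) {f : ℝ → ℝ} (hf : Measurable f)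
    (k : ℕ) : ∫ ω, f (V k ω) ∂Q = ∫ ω, f (X ω) ∂P :=
  ((h.identDistrib k).comp hf).integral_eq

lemma IsEpochSample.nonneg (h : IsEpochSample P X α Q V M) (hX0 : ∀ ω, 0 ≤ X ω) :
    ∀ᵐ ω ∂Q, ∀ k, 0 ≤ V k ω :=
  ae_all_iff.2 fun k => (h.identDistrib k).symm.ae_snd (p := fun x => 0 ≤ x) measurableSet_Ici
    (Eventually.of_forall hX0)

lemma IsEpochSample.integral_count [IsProbabilityMeasure Q]
    (h : IsEpochSample P X α Q V M) (hα : 0 ≤ α) (hα₁ : α < 1)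
    {Z : ℕ → Ω' → ℝ} (hZ : ∀ m, Integrable (Z m) Q) (hZ0 : ∀ m, 0 ≤ᵐ[Q] Z m) (hz : Z 0 = 0)
    {φ : ℕ → (ℕ → ℝ) → ℝ} (hφ : ∀ m, Measurable (φ m)) (hZφ : ∀ m ω, Z m ω = φ m fun k => V k ω)
    {c : ℝ} (hc : HasSum (fun j : ℕ => α ^ j * (1 - α) * ∫ ω, Z (j + 1) ω ∂Q) c) :
    Integrable (fun ω => Z (M ω) ω) Q ∧ ∫ ω, Z (M ω) ω ∂Q = c := by
  refine integral_random_index h.measurable_count hZ hZ0 (fun m => ?_) ?_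
  · have := h.indepFun_count.comp measurable_id (hφ m)
    rwa [show Z m = φ m ∘ fun ω k => V k ω from funext (hZφ m)]
  · have h0 : ∀ j : ℕ, Q.real {ω | M ω = j + 1} = α ^ j * (1 - α) := fun j => by
      rw [measureReal_def, h.geometric, ENNReal.toReal_ofReal]
      have := sub_pos.2 hα₁
      positivity
    rw [← hasSum_nat_add_iff' 1]
    simpa [h0, hz] using hc

lemma IsEpochSample.memLp_sum (h : IsEpochSample P X α Q V M) (hX : MemLp X 2 P) (m : ℕ) :
    MemLp (fun ω => ∑ k ∈ Finset.Icc 1 m, V k ω) 2 Q :=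
  memLp_finsetSum _ fun k _ => h.memLp hX k

lemma IsEpochSample.integral_sum [IsProbabilityMeasure Q]
    (h : IsEpochSample P X α Q V M) (hX : MemLp X 2 P) (m : ℕ) :
    ∫ ω, ∑ k ∈ Finset.Icc 1 m, V k ω ∂Q = m * ∫ ω, X ω ∂P := by
  rw [integral_finsetSum _ fun k _ => (h.memLp hX k).integrable one_le_two]
  have : ∀ k, ∫ ω, V k ω ∂Q = ∫ ω, X ω ∂P := fun k => h.integral_comp measurable_id k
  simp [this]

lemma IsEpochSample.integral_sum_sq [IsProbabilityMeasure Q]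
    (h : IsEpochSample P X α Q V M) (hX : MemLp X 2 P) (m : ℕ) :
    ∫ ω, (∑ k ∈ Finset.Icc 1 m, V k ω) ^ 2 ∂Q =
      m * (∫ ω, X ω ^ 2 ∂P - (∫ ω, X ω ∂P) ^ 2) + (m * ∫ ω, X ω ∂P) ^ 2 := by
  have h1 := variance_eq_sub (h.memLp_sum hX m)
  have h2 := IndepFun.variance_sum (s := Finset.Icc 1 m) (fun k _ => h.memLp hX k)
    fun i _ j _ hij => h.iIndepFun_delay.indepFun hij
  have h3 : ∀ k, Var[V k; Q] = ∫ ω, X ω ^ 2 ∂P - (∫ ω, X ω ∂P) ^ 2 := fun k => by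
    rw [variance_eq_sub (h.memLp hX k)]
    have e1 := h.integral_comp (f := fun x => x) measurable_id k
    have e2 := h.integral_comp (f := fun x => x ^ 2) (by fun_prop) k
    simp only [Pi.pow_apply, e1, e2]
  rw [show (∑ k ∈ Finset.Icc 1 m, V k) = fun ω => ∑ k ∈ Finset.Icc 1 m, V k ω by ext; simp] at h2
  rw [h2] at h1
  simp only [h3, Finset.sum_const, Nat.card_Icc, add_tsub_cancel_right, nsmul_eq_mul,
    h.integral_sum hX m, Pi.pow_apply] at h1
  linarith

/-- Moments of the geometric sum of delays; `φ (V 0)` stands for a nonnegative function of the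
preceding delay. -/
lemma IsEpochSample.moments [IsProbabilityMeasure Q]
    (h : IsEpochSample P X α Q V M) (hα : 0 ≤ α) (hα₁ : α < 1)
    (hX : MemLp X 2 P) (hX0 : ∀ ω, 0 ≤ X ω) {φ : ℝ → ℝ} (hφ : Measurable φ)
    (hφ0 : ∀ x, 0 ≤ x → 0 ≤ φ x) (hφ2 : Integrable (fun ω => φ (X ω)) P) :
    (Integrable (fun ω => φ (V 0 ω) * delaySum V M ω) Q ∧
      ∫ ω, φ (V 0 ω) * delaySum V M ω ∂Q = (∫ ω, φ (X ω) ∂P) * ((∫ ω, X ω ∂P) / (1 - α))) ∧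
    Integrable (fun ω => delaySum V M ω ^ 2) Q ∧
      ∫ ω, delaySum V M ω ^ 2 ∂Q =
        (∫ ω, X ω ^ 2 ∂P) / (1 - α) + 2 * α * ((∫ ω, X ω ∂P) / (1 - α)) ^ 2 := by
  have h1α : 1 - α ≠ 0 := by linarith
  have hV0 := h.nonneg hX0
  have hφi : Integrable (fun ω => φ (V 0 ω)) Q :=
    ((h.identDistrib 0).comp hφ).integrable_iff.2 hφ2
  refine ⟨?_, ?_⟩
  · have hprod : ∀ k ≠ 0, Integrable (fun ω => φ (V 0 ω) * V k ω) Q ∧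
        ∫ ω, φ (V 0 ω) * V k ω ∂Q = (∫ ω, φ (X ω) ∂P) * ∫ ω, X ω ∂P := fun k hk => by
      have hind : IndepFun (fun ω => φ (V 0 ω)) (V k) Q :=
        (h.iIndepFun_delay.indepFun hk.symm).comp hφ measurable_id
      have hi := (h.memLp hX k).integrable one_le_two
      refine ⟨hind.integrable_mul hφi hi, ?_⟩
      rw [hind.integral_fun_mul_eq_mul_integral hφi.aestronglyMeasurable hi.aestronglyMeasurable,
        h.integral_comp hφ]
      congr 1
      exact h.integral_comp measurable_id k
    have hk : ∀ {m k : ℕ}, k ∈ Finset.Icc 1 m → k ≠ 0 := fun hk =>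
      Nat.one_le_iff_ne_zero.1 (Finset.mem_Icc.1 hk).1
    refine h.integral_count hα hα₁ (Z := fun m ω => φ (V 0 ω) * ∑ k ∈ Finset.Icc 1 m, V k ω)
      (φ := fun m v => φ (v 0) * ∑ k ∈ Finset.Icc 1 m, v k) (fun m => ?_) (fun m => ?_) ?_
      (fun m => ?_) (fun m ω => rfl) ?_
    · simp_rw [Finset.mul_sum]
      exact integrable_finsetSum _ fun k hk' => (hprod k (hk hk')).1
    · filter_upwards [hV0] with ω hω
      exact mul_nonneg (hφ0 _ (hω 0)) (Finset.sum_nonneg fun k _ => hω k)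
    · ext ω
      simp
    · fun_prop
    · have hm : ∀ m : ℕ, ∫ ω, φ (V 0 ω) * ∑ k ∈ Finset.Icc 1 m, V k ω ∂Q =
          m * ((∫ ω, φ (X ω) ∂P) * ∫ ω, X ω ∂P) := fun m => by
        simp_rw [Finset.mul_sum]
        rw [integral_finsetSum _ fun k hk' => (hprod k (hk hk')).1,
          Finset.sum_congr rfl fun k hk' => (hprod k (hk hk')).2]
        simp
      simp_rw [hm]
      convert! (hasSum_geometric_mean hα hα₁).mul_right ((∫ ω, φ (X ω) ∂P) * ∫ ω, X ω ∂P) using 1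
      · ext j
        push_cast
        ring
      · ring
  · refine h.integral_count hα hα₁ (Z := fun m ω => (∑ k ∈ Finset.Icc 1 m, V k ω) ^ 2)
      (φ := fun m v => (∑ k ∈ Finset.Icc 1 m, v k) ^ 2)
      (fun m => (h.memLp_sum hX m).integrable_sq)
      (fun m => Eventually.of_forall fun ω => sq_nonneg _) ?_
      (fun m => ?_) (fun m ω => rfl) ?_
    · ext ω
      simp
    · fun_prop
    · simp_rw [h.integral_sum_sq hX]
      convert! ((hasSum_geometric_mean hα hα₁).mul_right
        (∫ ω, X ω ^ 2 ∂P - (∫ ω, X ω ∂P) ^ 2)).add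
        ((hasSum_geometric_sq hα hα₁).mul_right ((∫ ω, X ω ∂P) ^ 2)) using 1
      · ext j
        push_cast
        ring
      · field_simp
        ring

end Epoch

end

/-! ### The equation for `β` -/

section

variable {Ω Ω' : Type*} [MeasurableSpace Ω] [MeasurableSpace Ω'] {P : Measure Ω} {Q : Measure Ω'}
  {X : Ω → ℝ} {α : ℝ} {V : ℕ → Ω' → ℝ} {M : Ω' → ℕ}

/-- The left-hand side of the equation for `β`, in terms of the mean `μ` and the second moment `κ` of
the geometric sum of delays. -/
def reducedRootFun (P : Measure Ω) (X : Ω → ℝ) (μ κ b : ℝ) : ℝ :=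
  ∫ ω, potential (b - μ) 0 (X ω) ∂P - b ^ 2 / 2 - μ ^ 2 / 2 + b * (∫ ω, X ω ∂P)
    + (κ - ∫ ω, X ω ^ 2 ∂P) / 2

lemma integrable_potential [IsProbabilityMeasure P] (hX : MemLp X 2 P) (hX0 : ∀ ω, 0 ≤ X ω)
    (v g : ℝ) : Integrable (fun ω => potential v g (X ω)) P := by
  simpa using integrable_potential_add hX hX0 v g 0

lemma IsEpochSample.rootFun_eq [IsProbabilityMeasure P] [IsProbabilityMeasure Q]
    (h : IsEpochSample P X α Q V M) (hα : 0 ≤ α) (hα₁ : α < 1) (hX : MemLp X 2 P)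
    (hX0 : ∀ ω, 0 ≤ X ω) (b : ℝ) :
    Integrable (epochCost Q α V M b) Q ∧ Integrable (epochLength Q α V b) Q ∧
      rootFun Q α V M b = reducedRootFun P X ((∫ ω, X ω ∂P) / (1 - α))
        ((∫ ω, X ω ^ 2 ∂P) / (1 - α) + 2 * α * ((∫ ω, X ω ∂P) / (1 - α)) ^ 2) b := by
  have hm : ∫ ω, V 0 ω ∂Q = ∫ ω, X ω ∂P := h.integral_comp measurable_id 0
  have hm2 : ∫ ω, V 0 ω ^ 2 ∂Q = ∫ ω, X ω ^ 2 ∂P :=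
    h.integral_comp (f := fun x => x ^ 2) (by fun_prop) 0
  set m := ∫ ω, X ω ∂P with hmdef
  set μ := m / (1 - α) with hμ
  have hV := h.memLp hX 0
  have hVi := hV.integrable one_le_two
  have hVs := hV.integrable_sq
  have hXi := hX.integrable one_le_two
  have hwm : Measurable fun x : ℝ => max (b - μ) x := by fun_prop
  have hwX : Integrable (fun ω => max (b - μ) (X ω)) P := (integrable_const (b - μ)).sup hXi
  have hwV : Integrable (fun ω => max (b - μ) (V 0 ω)) Q := (integrable_const (b - μ)).sup hVi
  obtain ⟨⟨hi1, he1⟩, hi2, he2⟩ := h.moments hα hα₁ hX hX0 hwm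
    (fun x hx => hx.trans (le_max_right _ _)) hwX
  have hw : ∫ ω, max (b - μ) (V 0 ω) ∂Q = ∫ ω, max (b - μ) (X ω) ∂P := h.integral_comp hwm 0
  rw [← hw] at he1
  -- the potential with threshold `b - μ` collects the terms in the square of `max (b - μ) Y`
  have hpotm := measurable_potential (b - μ) 0
  have hpi : Integrable (fun ω => potential (b - μ) 0 (V 0 ω)) Q :=
    ((h.identDistrib 0).comp hpotm).integrable_iff.2 (integrable_potential hX hX0 (b - μ) 0)
  have hpe : ∫ ω, potential (b - μ) 0 (V 0 ω) ∂Q = ∫ ω, potential (b - μ) 0 (X ω) ∂P :=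
    h.integral_comp hpotm 0
  have hcost : epochCost Q α V M b = fun ω =>
      potential (b - μ) 0 (V 0 ω) + (b - μ) * max (b - μ) (V 0 ω) - (b - μ) ^ 2 / 2
        - 1 / 2 * V 0 ω ^ 2 + max (b - μ) (V 0 ω) * delaySum V M ω
        + 1 / 2 * delaySum V M ω ^ 2 := by
    ext ω
    rw [epochCost, integral_id, hm, potential]
    rcases max_cases (b - μ) (V 0 ω) with ⟨h₁, h₁'⟩ | ⟨h₁, h₁'⟩ <;> rw [h₁]
    · rw [max_eq_right (by linarith)]
      ring
    · rw [max_eq_left (by linarith)]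
      ring
  have hlength : epochLength Q α V b = fun ω => max (b - μ) (V 0 ω) - V 0 ω + μ := by
    ext ω
    rw [epochLength, hm]
    rcases max_cases (b - μ) (V 0 ω) with ⟨h₁, h₁'⟩ | ⟨h₁, h₁'⟩ <;> rw [h₁]
    · rw [max_eq_left (by linarith)]
      ring
    · rw [max_eq_right (by linarith)]
      ring
  have i1 : Integrable (fun ω => potential (b - μ) 0 (V 0 ω) + (b - μ) * max (b - μ) (V 0 ω)) Q :=
    hpi.add (hwV.const_mul _)
  have i2 : Integrable (fun ω => potential (b - μ) 0 (V 0 ω) + (b - μ) * max (b - μ) (V 0 ω)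
      - (b - μ) ^ 2 / 2) Q := i1.sub (integrable_const _)
  have i3 : Integrable (fun ω => potential (b - μ) 0 (V 0 ω) + (b - μ) * max (b - μ) (V 0 ω)
      - (b - μ) ^ 2 / 2 - 1 / 2 * V 0 ω ^ 2) Q := i2.sub (hVs.const_mul _)
  have i4 : Integrable (fun ω => potential (b - μ) 0 (V 0 ω) + (b - μ) * max (b - μ) (V 0 ω)
      - (b - μ) ^ 2 / 2 - 1 / 2 * V 0 ω ^ 2 + max (b - μ) (V 0 ω) * delaySum V M ω) Q := i3.add hi1
  have i5 : Integrable (fun ω => max (b - μ) (V 0 ω) - V 0 ω) Q := hwV.sub hVi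
  refine ⟨hcost ▸ i4.add (hi2.const_mul _), hlength ▸ i5.add (integrable_const _), ?_⟩
  rw [rootFun, hcost, hlength, integral_add i4 (hi2.const_mul _), integral_add i3 hi1,
    integral_sub i2 (hVs.const_mul _), integral_sub i1 (integrable_const _),
    integral_add hpi (hwV.const_mul _), integral_add i5 (integrable_const _),
    integral_sub hwV hVi, integral_const_mul, integral_const_mul, integral_const_mul, he1, he2,
    hm, hm2, hpe, reducedRootFun]
  simp only [integral_const, probReal_univ, one_smul]
  ring

/-- The equation for `β` has exactly one root, as its left-hand side is continuous and decreases at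
rate at least `μ`, and this root is positive. -/
lemma exists_unique_root [IsProbabilityMeasure P] (hX : MemLp X 2 P) (hX0 : ∀ ω, 0 ≤ X ω)
    {μ κ : ℝ} (hμ : 0 < μ) (hm : 0 < ∫ ω, X ω ∂P) (hκ : 0 ≤ κ) :
    ∃ β, 0 < β ∧ ∀ b, reducedRootFun P X μ κ b = 0 ↔ b = β := by
  have hXi := hX.integrable one_le_two
  have hdecr : ∀ b b', b ≤ b' →
      reducedRootFun P X μ κ b' + μ * (b' - b) ≤ reducedRootFun P X μ κ b := fun b b' hbb => by
    have hp := integrable_potential hX hX0 (b - μ) 0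
    have hp' := integrable_potential hX hX0 (b' - μ) 0
    have hle : ∫ ω, ((b' - b) * (μ - (b + b') / 2) + (b' - b) * X ω) ∂P ≤
        ∫ ω, (potential (b - μ) 0 (X ω) - potential (b' - μ) 0 (X ω)) ∂P := by
      refine integral_mono ((integrable_const _).add (hXi.const_mul _)) (hp.sub hp') fun ω => ?_
      simp only [potential]
      rcases max_cases (X ω - (b - μ)) 0 with ⟨h₁, h₁'⟩ | ⟨h₁, h₁'⟩ <;>
      rcases max_cases (X ω - (b' - μ)) 0 with ⟨h₂, h₂'⟩ | ⟨h₂, h₂'⟩ <;> rw [h₁, h₂]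
      · apply le_of_eq
        ring
      · nlinarith [sq_nonneg (X ω - (b' - μ))]
      · nlinarith
      · nlinarith
    rw [integral_sub hp hp', integral_add (integrable_const _) (hXi.const_mul _),
      integral_const_mul (b' - b) X] at hle
    simp only [integral_const, probReal_univ, one_smul] at hle
    simp only [reducedRootFun]
    nlinarith
  have hpos : 0 < reducedRootFun P X μ κ 0 := by
    have : ∀ ω, potential (0 - μ) 0 (X ω) = μ ^ 2 / 2 + μ * X ω + 1 / 2 * X ω ^ 2 := fun ω => by
      rw [potential, max_eq_left (by linarith [hX0 ω])]
      ring
    simp only [reducedRootFun, this]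
    rw [integral_affine_add_sq hX]
    have := mul_pos hμ hm
    nlinarith
  obtain ⟨B, hB0, hB⟩ : ∃ B, 0 ≤ B ∧ reducedRootFun P X μ κ B ≤ 0 := by
    refine ⟨reducedRootFun P X μ κ 0 / μ, by positivity, ?_⟩
    have := hdecr 0 (reducedRootFun P X μ κ 0 / μ) (by positivity)
    rw [sub_zero, mul_div_cancel₀ _ hμ.ne'] at this
    linarith
  have hcont : ContinuousOn (reducedRootFun P X μ κ) (Set.Icc 0 B) := by
    have hpc : ContinuousOn (fun b => ∫ ω, potential (b - μ) 0 (X ω) ∂P) (Set.Icc 0 B) := by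
      refine continuousOn_of_dominated (bound := fun ω => potential (-μ) 0 (X ω))
        (fun b _ => (integrable_potential hX hX0 (b - μ) 0).aestronglyMeasurable)
        (fun b hb => Eventually.of_forall fun ω => ?_) (integrable_potential hX hX0 (-μ) 0)
        (Eventually.of_forall fun ω => ?_)
      · have h1 : max (X ω - (b - μ)) 0 ≤ max (X ω - -μ) 0 :=
          max_le_max (by linarith [hb.1]) le_rfl
        have h2 := pow_le_pow_left₀ (le_max_right _ _) h1 2
        simp only [potential, zero_add]
        rw [Real.norm_of_nonneg (by positivity)]
        linarith
      · simp only [potential]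
        fun_prop
    unfold reducedRootFun
    fun_prop
  obtain ⟨β, hβ, hroot⟩ := intermediate_value_Icc' hB0 hcont ⟨hB, hpos.le⟩
  refine ⟨β, lt_of_le_of_ne hβ.1 fun h0 => ?_, fun b => ⟨fun hb => ?_, fun hb => hb ▸ hroot⟩⟩
  · rw [← h0] at hroot
    exact hpos.ne' hroot
  · rcases lt_trichotomy b β with hlt | heq | hlt
    · have := hdecr b β hlt.le
      rw [hb, hroot] at this
      nlinarith
    · exact heq
    · have := hdecr β b hlt.le
      rw [hb, hroot] at this
      nlinarith

/-- The root of the equation is the value for which the optimality equation has a solution. -/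
lemma exists_isOptimalPotential [IsProbabilityMeasure P] (hX : MemLp X 2 P) (hX0 : ∀ ω, 0 ≤ X ω)
    (hα₁ : α < 1) {β : ℝ} (hβ : reducedRootFun P X ((∫ ω, X ω ∂P) / (1 - α))
      ((∫ ω, X ω ^ 2 ∂P) / (1 - α) + 2 * α * ((∫ ω, X ω ∂P) / (1 - α)) ^ 2) β = 0) :
    ∃ g, IsOptimalPotential P α X (β - (∫ ω, X ω ∂P) / (1 - α)) ((∫ ω, X ω ∂P) / (1 - α)) g := by
  have h1α : 1 - α ≠ 0 := by linarith
  set μ := (∫ ω, X ω ∂P) / (1 - α) with hμ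
  have hmean : (1 - α) * μ = ∫ ω, X ω ∂P := by rw [hμ]; field_simp
  refine ⟨((β - μ) ^ 2 + 2 * (β - μ) * (∫ ω, X ω ∂P) + ∫ ω, X ω ^ 2 ∂P) / 2
    - (β - μ + μ) * (β - μ + ∫ ω, X ω ∂P) + α * (∫ ω, X ω ^ 2 ∂P) / 2 / (1 - α), hmean, ?_, ?_⟩
  · field_simp
    ring
  · set g := ((β - μ) ^ 2 + 2 * (β - μ) * (∫ ω, X ω ∂P) + ∫ ω, X ω ^ 2 ∂P) / 2
      - (β - μ + μ) * (β - μ + ∫ ω, X ω ∂P) + α * (∫ ω, X ω ^ 2 ∂P) / 2 / (1 - α) with hg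
    have hp := integrable_potential hX hX0 (β - μ) 0
    have hpt : ∀ ω, potential (β - μ) g (X ω) - (X ω ^ 2 / 2 - (β - μ + μ) * X ω) =
        potential (β - μ) 0 (X ω) + (g + β * X ω + (-(1 / 2)) * X ω ^ 2) := fun ω => by
      simp only [potential]
      ring
    simp_rw [hpt]
    have hq : Integrable (fun ω => g + β * X ω + (-(1 / 2)) * X ω ^ 2) P :=
      ((integrable_const _).add ((hX.integrable one_le_two).const_mul _)).add
        (hX.integrable_sq.const_mul _)
    rw [integral_add hp hq, integral_affine_add_sq hX]
    rw [reducedRootFun] at hβ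
    have hfrac : (∫ ω, X ω ^ 2 ∂P) / (1 - α) =
        (∫ ω, X ω ^ 2 ∂P) + α * (∫ ω, X ω ^ 2 ∂P) / (1 - α) := by
      field_simp
      ring
    rw [hfrac] at hβ
    rw [hg]
    rw [show α * (∫ ω, X ω ^ 2 ∂P) / 2 / (1 - α) = α * (∫ ω, X ω ^ 2 ∂P) / (1 - α) / 2 by ring]
    linear_combination hβ + μ * hmean

end

/-! ### The threshold rule -/

section

section Existence

variable {Ω : Type*} {Y S : ℕ → Ω → ℝ} {C : ℕ → Ω → Bool} {v : ℝ}

/-- The feedback time and the generation time of the freshest sample under the threshold rule. -/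
def thresholdState (Y : ℕ → Ω → ℝ) (C : ℕ → Ω → Bool) (v : ℝ) : ℕ → Ω → ℝ × ℝ
  | 0 => fun _ => (0, 0)
  | i + 1 => fun ω =>
    let p := thresholdState Y C v i ω
    (max p.1 (v + p.2) + Y i ω, if C i ω = true then max p.1 (v + p.2) else p.2)

lemma exists_eq_max (Y : ℕ → Ω → ℝ) (C : ℕ → Ω → Bool) (v : ℝ) :
    ∃ S : ℕ → Ω → ℝ, ∀ i ω, S i ω = max (feedback S Y i ω) (v + lastFresh S C i ω) := by
  let S : ℕ → Ω → ℝ := fun i ω =>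
    max (thresholdState Y C v i ω).1 (v + (thresholdState Y C v i ω).2)
  have h : ∀ i ω, feedback S Y i ω = (thresholdState Y C v i ω).1 ∧
      lastFresh S C i ω = (thresholdState Y C v i ω).2 := by
    intro i ω
    induction i with
    | zero => exact ⟨rfl, rfl⟩
    | succ i ih =>
      refine ⟨rfl, ?_⟩
      simp only [lastFresh, thresholdState, ih.2, S]
  exact ⟨S, fun i ω => by rw [(h i ω).1, (h i ω).2]⟩

/-- The first time at which the age reaches `v` is explicit, since the age is affine until the next
feedback. -/
lemma isAgeThresholdPolicy_iff {ε : ℝ} (hε : 0 < ε) (hY : ∀ i ω, ε ≤ Y i ω) :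
    IsAgeThresholdPolicy Y C v S ↔
      ∀ i ω, S i ω = max (feedback S Y i ω) (v + lastFresh S C i ω) := by
  constructor
  · intro h i ω
    have hf : IsFeasibleAt S Y ε ω := ⟨hε, fun i => (h i ω).1.1, fun i => hY i ω⟩
    obtain ⟨⟨h₁, h₂⟩, h₃⟩ := h i ω
    rw [hf.age_eq h₁ (hf.sample_lt i)] at h₂
    refine le_antisymm (le_of_not_gt fun hlt => ?_) (max_le h₁ (by linarith))
    refine hlt.not_ge (h₃ ⟨le_max_left _ _, ?_⟩)
    rw [hf.age_eq (le_max_left _ _) (hlt.trans (hf.sample_lt i))]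
    linarith [le_max_right (feedback S Y i ω) (v + lastFresh S C i ω)]
  · intro h i ω
    have hf : IsFeasibleAt S Y ε ω :=
      ⟨hε, fun i => (h i ω).symm ▸ le_max_left _ _, fun i => hY i ω⟩
    refine ⟨⟨hf.feasible i, ?_⟩, ?_⟩
    · rw [hf.age_eq (hf.feasible i) (hf.sample_lt i), h i ω]
      linarith [le_max_right (feedback S Y i ω) (v + lastFresh S C i ω)]
    · rintro t ⟨ht₁, ht₂⟩
      by_contra! hlt
      rw [hf.age_eq ht₁ (hlt.trans (hf.sample_lt i))] at ht₂
      exact hlt.not_ge (by rw [h i ω]; exact max_le ht₁ (by linarith))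

/-- Under the threshold rule, sampling times are functions of the preceding transmissions. -/
lemma measurable_threshold (h : ∀ i ω, S i ω = max (feedback S Y i ω) (v + lastFresh S C i ω))
    (i : ℕ) {m : MeasurableSpace Ω} (hm : ∀ k < i, Measurable[m] fun ω => (Y k ω, C k ω)) :
    Measurable[m] (S i) := by
  have key : ∀ j ≤ i, Measurable[m] (feedback S Y j) ∧ Measurable[m] (lastFresh S C j) := by
    intro j hj
    induction j with
    | zero => exact ⟨measurable_const, measurable_const⟩
    | succ j ih =>
      obtain ⟨h₁, h₂⟩ := ih (by omega)
      have hS : Measurable[m] (S j) := by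
        rw [show S j = fun ω => max (feedback S Y j ω) (v + lastFresh S C j ω) from funext (h j)]
        exact h₁.max (h₂.const_add v)
      have hYC := hm j (by omega)
      exact ⟨hS.add (measurable_fst.comp hYC),
        Measurable.ite ((measurable_snd.comp hYC) (measurableSet_singleton true)) hS h₂⟩
  rw [show S i = fun ω => max (feedback S Y i ω) (v + lastFresh S C i ω) from funext (h i)]
  exact (key i le_rfl).1.max ((key i le_rfl).2.const_add v)

lemma measurable_history_threshold
    (h : ∀ i ω, S i ω = max (feedback S Y i ω) (v + lastFresh S C i ω)) (i : ℕ)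
    {m : MeasurableSpace Ω} (hm : ∀ k < i, Measurable[m] fun ω => (Y k ω, C k ω)) :
    Measurable[m] (history S Y C i) := by
  have h₁ : Measurable[m] fun ω (j : Fin (i + 1)) => S j ω := measurable_pi_lambda _ fun j =>
    measurable_threshold h j fun k hk => hm k (hk.trans_le (Nat.lt_succ_iff.1 j.2))
  have h₂ : Measurable[m] fun ω (j : Fin i) => (Y j ω, C j ω) :=
    measurable_pi_lambda _ fun j => hm j j.2
  exact h₁.prodMk h₂

end Existence

variable {Ω : Type*} [MeasurableSpace Ω] {P : Measure Ω} [IsProbabilityMeasure P] {α v : ℝ}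
  {Y S : ℕ → Ω → ℝ} {C : ℕ → Ω → Bool} {W : ℝ≥0 → Ω → ℝ}

lemma IsUnreliableChannel.isSignalAgnostic (hch : IsUnreliableChannel P α Y C)
    (hWchannel : IndepFun (fun ω t => W t ω) (fun ω i => (Y i ω, C i ω)) P)
    (h : ∀ i ω, S i ω = max (feedback S Y i ω) (v + lastFresh S C i ω)) :
    IsSignalAgnostic P W Y C S where
  measurable i := measurable_threshold h i fun k _ =>
    (hch.measurable_delay k).prodMk (hch.measurable_state k)
  agnostic := by
    rw [IndepFun_iff_Indep] at hWchannel ⊢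
    refine indep_of_indep_of_le_right hWchannel ?_
    let m : MeasurableSpace Ω :=
      MeasurableSpace.comap (fun ω i => (Y i ω, C i ω)) MeasurableSpace.pi
    have hYC : ∀ k, Measurable[m] fun ω => (Y k ω, C k ω) := fun k =>
      (measurable_pi_apply k).comp (comap_measurable fun ω i => (Y i ω, C i ω))
    have : Measurable[m] fun ω i => (S i ω, Y i ω, C i ω) := measurable_pi_lambda _ fun i =>
      (measurable_threshold h i fun k _ => hYC k).prodMk (hYC i)
    exact this.comap_le
  causal i := by
    let m : ℕ → MeasurableSpace Ω := fun k =>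
      MeasurableSpace.comap (fun ω => (Y k ω, C k ω)) inferInstance
    have hind := indep_iSup_of_disjoint (m := m) (S := Set.Iio i) (T := Set.Ici i)
      (fun k => ((hch.measurable_delay k).prodMk (hch.measurable_state k)).comap_le)
      hch.iIndepFun_pair (Set.Iio_disjoint_Ici le_rfl)
    rw [IndepFun_iff_Indep]
    have hle : ∀ (s : Set ℕ), ∀ k ∈ s, Measurable[⨆ k ∈ s, m k] fun ω => (Y k ω, C k ω) :=
      fun s k hk => (comap_measurable fun ω => (Y k ω, C k ω)).mono
        (le_iSup₂ (f := fun k _ => m k) k hk) le_rfl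
    refine indep_of_indep_of_le_left (indep_of_indep_of_le_right hind ?_) ?_
    · exact (@measurable_pi_lambda Ω ℕ (fun _ => ℝ × Bool) (⨆ k ∈ Set.Ici i, m k) _
        (fun ω k => (Y (i + k) ω, C (i + k) ω))
        fun k => hle _ (i + k) (Nat.le_add_right i k)).comap_le
    · exact (measurable_history_threshold h i fun k hk => hle (Set.Iio i) k hk).comap_le
  feasible i ω := (h i ω).symm ▸ le_max_left _ _
  bounded i := by
    obtain ⟨ε, hε, hY⟩ := hch.delay_ge
    refine ⟨fun _ => max v 0, memLp_const _, Eventually.of_forall fun ω => ?_,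
      fun k _ => indepFun_const_left _ _⟩
    have hf : IsFeasibleAt S Y ε ω :=
      ⟨hε, fun i => (h i ω).symm ▸ le_max_left _ _, fun i => hY i ω⟩
    have hu := hf.lastFresh_le_feedback (C := C) i
    have h1 := le_max_left v 0
    have h2 := le_max_right v 0
    rw [h i ω, sub_le_iff_le_add]
    exact max_le (by linarith) (by linarith)

end

end Sampling

end

/-! ### The optimal policy -/

theorem mainTheorem8
    {Ω : Type*} [MeasurableSpace Ω] (P : Measure Ω) [IsProbabilityMeasure P]
    (α : ℝ) (hα₀ : 0 ≤ α) (hα₁ : α < 1)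
    -- the unreliable channel
    (Y : ℕ → Ω → ℝ) (C : ℕ → Ω → Bool) (hchannel : Sampling.IsUnreliableChannel P α Y C)
    -- the Wiener process, independent of the channel
    (W : ℝ≥0 → Ω → ℝ) (hWmeas : ∀ t, Measurable (W t)) (hW : IsBrownianReal W P)
    (hWchannel : IndepFun (fun ω t => W t ω) (fun ω i => (Y i ω, C i ω)) P)
    -- the random variables in the equation for `β`
    {Ω' : Type*} [MeasurableSpace Ω'] (Q : Measure Ω') [IsProbabilityMeasure Q]
    (V : ℕ → Ω' → ℝ) (M : Ω' → ℕ) (hepoch : Sampling.IsEpochSample P (Y 0) α Q V M) :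
    -- the expectations in the equation for `β` are finite
    (∀ b : ℝ, Integrable (Sampling.epochCost Q α V M b) Q ∧
      Integrable (Sampling.epochLength Q α V b) Q) ∧
    ∃ β : ℝ, 0 < β ∧
      -- `β` is the unique root of the equation, and the optimal value
      (∀ b : ℝ, Sampling.rootFun Q α V M b = 0 ↔ b = β) ∧
      Sampling.ageOpt P W Y C = ENNReal.ofReal β ∧
      Sampling.mseOpt P W Y C = ENNReal.ofReal β ∧
      -- the age-threshold policy exists, is admissible and is optimal
      (∃ S : ℕ → Ω → ℝ,
        Sampling.IsAgeThresholdPolicy Y C (β - (∫ ω, Y 0 ω ∂P) / (1 - α)) S) ∧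
      ∀ S : ℕ → Ω → ℝ,
        Sampling.IsAgeThresholdPolicy Y C (β - (∫ ω, Y 0 ω ∂P) / (1 - α)) S →
          Sampling.IsSignalAgnostic P W Y C S ∧
          Sampling.avgAge P Y C S = Sampling.ageOpt P W Y C ∧
          Sampling.avgMSE P W Y C S = Sampling.mseOpt P W Y C := by
  obtain ⟨ε, hε, hYε⟩ := hchannel.delay_ge
  have hX := hchannel.memLp_delay 0
  have hX0 := hchannel.delay_nonneg 0
  have h1α : 0 < 1 - α := by linarith
  have hm : 0 < ∫ ω, Y 0 ω ∂P := by
    have : ∫ _, ε ∂P ≤ ∫ ω, Y 0 ω ∂P :=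
      integral_mono (integrable_const _) (hX.integrable one_le_two) fun ω => hYε 0 ω
    rw [integral_const, probReal_univ, one_smul] at this
    linarith
  have hμ : 0 < (∫ ω, Y 0 ω ∂P) / (1 - α) := div_pos hm h1α
  have hκ : 0 ≤ (∫ ω, Y 0 ω ^ 2 ∂P) / (1 - α) + 2 * α * ((∫ ω, Y 0 ω ∂P) / (1 - α)) ^ 2 := by
    have : 0 ≤ ∫ ω, Y 0 ω ^ 2 ∂P := integral_nonneg fun ω => sq_nonneg _
    positivity
  have hroot := hepoch.rootFun_eq hα₀ hα₁ hX hX0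
  refine ⟨fun b => ⟨(hroot b).1, (hroot b).2.1⟩, ?_⟩
  obtain ⟨β, hβ, hβroot⟩ := Sampling.exists_unique_root hX hX0 hμ hm hκ
  obtain ⟨g, hg⟩ := Sampling.exists_isOptimalPotential hX hX0 hα₁ ((hβroot β).2 rfl)
  have hvμ : β - (∫ ω, Y 0 ω ∂P) / (1 - α) + (∫ ω, Y 0 ω ∂P) / (1 - α) = β := by ring
  have hβ' := hβ
  rw [← hvμ] at hβ'
  obtain ⟨S, hS⟩ := Sampling.exists_eq_max Y C (β - (∫ ω, Y 0 ω ∂P) / (1 - α))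
  have hlower : ∀ S, Sampling.IsSignalAgnostic P W Y C S →
      ENNReal.ofReal β ≤ Sampling.avgAge P Y C S := fun S hS => by
    have := hchannel.le_avgAge hα₀ hα₁ hS.measurable hS.feasible hS.causal hg hμ.le hβ'
    rwa [hvμ] at this
  have hthr : ∀ S, (∀ i ω, S i ω = max (Sampling.feedback S Y i ω)
      (β - (∫ ω, Y 0 ω ∂P) / (1 - α) + Sampling.lastFresh S C i ω)) →
      Sampling.IsSignalAgnostic P W Y C S ∧ Sampling.avgAge P Y C S = ENNReal.ofReal β :=
    fun S hS => by
      have hag := hchannel.isSignalAgnostic hWchannel hS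
      have := hchannel.avgAge_le hα₀ hag.measurable hag.feasible hag.causal hg hμ.le hβ' hS
      rw [hvμ] at this
      exact ⟨hag, le_antisymm this (hlower S hag)⟩
  have hage : Sampling.ageOpt P W Y C = ENNReal.ofReal β :=
    le_antisymm ((iInf₂_le S (hthr S hS).1).trans (hthr S hS).2.le) (le_iInf₂ hlower)
  have hmse : Sampling.mseOpt P W Y C = ENNReal.ofReal β := by
    rw [← hage]
    exact iInf_congr fun S => iInf_congr fun hS => hS.avgMSE_eq_avgAge hchannel hWmeas hW
  refine ⟨β, hβ, fun b => by rw [(hroot b).2.2]; exact hβroot b, hage, hmse,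
    ⟨S, (Sampling.isAgeThresholdPolicy_iff hε hYε).2 hS⟩, fun S hS => ?_⟩
  obtain ⟨hag, hval⟩ := hthr S ((Sampling.isAgeThresholdPolicy_iff hε hYε).1 hS)
  refine ⟨hag, hval.trans hage.symm, ?_⟩
  rw [hag.avgMSE_eq_avgAge hchannel hWmeas hW, hval, hmse]
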